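/- **Theorem (IGP-UCB uncertain-inputs regret).** Let $\mathcal X\subseteq\mathbb R^d$, let $S\subseteq\mathcal X$ be compact, and let $k:\mathcal X\times\mathcal X\to\mathbb R$ be a continuous positive-definite kernel with $k(x,x)\le 1$ for all $x$, with reproducing kernel Hilbert space $\mathcal H_k$; let $\mathcal H_k(S)$ be the reproducing kernel Hilbert space of the restriction of $k$ to $S\times S$. Let $f\in\mathcal H_k$, $B\in\mathbb R$, $\sigma_q>0$, $\sigma_\zeta\ge 0$, $\delta\in(0,1)$, $\lambda\ge 1$, and let $x\mapsto P^q_x$ be a Markov kernel from $S$ to $\mathcal X$. *Setting.* At round $t=1,2,\dots$ a target $x_t\in S$ is selected, $f$ is queried at a random location $X_t$, and $y_t=f(X_t)+\zeta_t$ is observed. Put $g(x)=\mathbb E_{P^q_x}[f]$ and $\nu_t=y_t-g(x_t)$, and let $\mathcal F_t$ be the $\sigma$-algebra generated by $(x_i,\nu_i)_{i\le t}$. Each $x_t$ is $\mathcal F_{t-1}$-measurable, and given $\mathcal F_{t-1}$ the location $X_t$ has law $P^q_{x_t}$ and is independent of $\zeta_t$. The uncertain-inputs cumulative regret is $\bar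 R_n=\sum_{t=1}^n\bigl(\max_{x\in S}g(x)-g(x_t)\bigr)$. For $n\ge 0$ let $\gamma_n$ be the maximum, over all $n$-tuples of points of $S$ (repetitions allowed), of the mutual information between $\mathbf g_n\sim N(0,K_n)$ and $\mathbf y_n=\mathbf g_n+\boldsymbol\nu'_n$, where $K_n$ is the Gram matrix of $k$ on the tuple and $\boldsymbol\nu'_n\sim N(0,\lambda I)$ is independent of $\mathbf g_n$. Let $\mathbf x_{t-1}=(x_1,\dots,x_{t-1})$ and $\mathbf y_{t-1}=(y_1,\dots,y_{t-1})^{\mathsf T}$, let $\mathbf k_{t-1}(x)=(k(x,x_i))_{i<t}$ and $K_{t-1}=(k(x_i,x_j))_{i,j<t}$. IGP-UCB with parameters $\lambda,(\beta_t)$ selects $x_t$ as a maximiser over $x\in S$ of $\mu_{t-1}(x)+\beta_t\sigma_{t-1}(x)$, where $$\mu_{t-1}(x)=\mathbf k_{t-1}(x)^{\mathsf T}(K_{t-1}+\lambda I)^{-1}\mathbf y_{t-1},\qquad \sigma_{t-1}^2(x)=k(x,x)-\mathbf k_{t-1}(x)^{\mathsf T}(K_{t-1}+\lambda I)^{-1}\mathbf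 k_{t-1}(x).$$ *Assumptions.* 1. $g\in\mathcal H_k(S)$ and $\|g\|_k\le B$. 2. For every $x\in S$, $f(X)-\mathbb E_{P^q_x}[f]$ with $X\sim P^q_x$ is $\sigma_q$-sub-Gaussian. 3. For every $t\ge1$, $\zeta_t$ is conditionally $\sigma_\zeta$-sub-Gaussian: $\mathbb E[e^{s\zeta_t}\mid\mathcal F_{t-1}]\le e^{s^2\sigma_\zeta^2/2}$ a.s. for all $s\in\mathbb R$. *Conclusion.* Run IGP-UCB with $\sigma_\nu=\sqrt{\sigma_q^2+\sigma_\zeta^2}$ and $\beta_t=B+\sigma_\nu\sqrt{2(\gamma_{t-1}+1+\log(1/\delta))}$. Then $$\bar R_n\in O\Bigl(B\sqrt{n\gamma_n}+\sigma_\nu\sqrt{n\gamma_n(\gamma_n+\log(1/\delta))}\Bigr)$$ with probability at least $1-\delta$. Precisely: for every $\Lambda\ge 1$ there is a constant $C>0$ depending only on $\Lambda$ such that, in every setting as above with $1\le\lambda\le\Lambda$ (for instance $\lambda=1+2/N$ for a horizon $N\geq 1$, with $\Lambda=3$), $$\mathbb P\Bigl(\forall n\ge 0:\ \bar R_n\le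 C\bigl(B\sqrt{n\gamma_n}+\sigma_\nu\sqrt{n\gamma_n(\gamma_n+\log(1/\delta))}\bigr)\Bigr)\ge 1-\delta .$$ -/

import Mathlib

open MeasureTheory ProbabilityTheory
open scoped NNReal ENNReal

namespace UncertainBO

noncomputable section

/-- `H` is the reproducing kernel Hilbert space `H_k` of the real kernel `k` on `A`. Such an `H`
exists exactly when `k` is symmetric and positive (semi)definite. -/
def IsRKHSOf {A : Type*} (H : Type*) [NormedAddCommGroup H] [InnerProductSpace ℝ H]
    [CompleteSpace H] [RKHS ℝ H A ℝ] (k : A → A → ℝ) : Prop :=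
  ∀ x y : A, RKHS.kernel H x y 1 = k x y

section GaussianProcess

variable {A : Type*} (k : A → A → ℝ) (lam : ℝ)

/-- The Gram matrix `K_n` of the points `xs`. -/
def gram {n : ℕ} (xs : Fin n → A) : Matrix (Fin n) (Fin n) ℝ :=
  Matrix.of fun i j => k (xs i) (xs j)

/-- The vector `k_n(x)` of covariances between `x` and the points `xs`. -/
def covVec {n : ℕ} (xs : Fin n → A) (x : A) : Fin n → ℝ :=
  fun i => k x (xs i)

/-- The posterior mean `k_n(x)ᵀ (K_n + λ I)⁻¹ y` of `GP(0, k)` given the data `(xs, ys)`. -/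
def postMean {n : ℕ} (xs : Fin n → A) (ys : Fin n → ℝ) (x : A) : ℝ :=
  covVec k xs x ⬝ᵥ (gram k xs + lam • (1 : Matrix (Fin n) (Fin n) ℝ))⁻¹.mulVec ys

/-- The posterior variance `k(x, x) - k_n(x)ᵀ (K_n + λ I)⁻¹ k_n(x)` of `GP(0, k)`. -/
def postVar {n : ℕ} (xs : Fin n → A) (x : A) : ℝ :=
  k x x - covVec k xs x ⬝ᵥ
    (gram k xs + lam • (1 : Matrix (Fin n) (Fin n) ℝ))⁻¹.mulVec (covVec k xs x)

/-- The upper confidence bound `μ_n(x) + b σ_n(x)` given the data `(xs, ys)`. -/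
def ucb (b : ℝ) {n : ℕ} (xs : Fin n → A) (ys : Fin n → ℝ) (x : A) : ℝ :=
  postMean k lam xs ys x + b * Real.sqrt (postVar k lam xs x)

/-- The mutual information of two random elements with joint law `ρ`: the Kullback-Leibler
divergence of `ρ` from the product of its marginals. -/
def mutualInfo {α β : Type*} [MeasurableSpace α] [MeasurableSpace β] (ρ : Measure (α × β)) :
    ℝ≥0∞ :=
  InformationTheory.klDiv ρ (ρ.fst.prod ρ.snd)

/-- The joint law of `(y, g)` with `y = g + ν'`, where `g ∼ N(0, K_n)` and `ν' ∼ N(0, λ I)` are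
independent. -/
def obsLaw {n : ℕ} (xs : Fin n → A) :
    Measure (EuclideanSpace ℝ (Fin n) × EuclideanSpace ℝ (Fin n)) :=
  ((multivariateGaussian 0 (gram k xs)).prod
    (multivariateGaussian 0 (lam • (1 : Matrix (Fin n) (Fin n) ℝ)))).map
      fun p => (p.1 + p.2, p.1)

/-- The maximum information gain `γ_n` over all choices of `n` points of `A`, repetitions
allowed. -/
def maxInfoGain (n : ℕ) : ℝ :=
  (⨆ xs : Fin n → A, mutualInfo (obsLaw k lam xs)).toReal

end GaussianProcess

/-- `β = B + σ √(2 (γ_t + 1 + log (1 / δ)))`, where `t` is the number of past observations. -/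
def igpBeta {A : Type*} (k : A → A → ℝ) (lam B σ δ : ℝ) (t : ℕ) : ℝ :=
  B + σ * Real.sqrt (2 * (maxInfoGain k lam t + 1 + Real.log (1 / δ)))

/-- `Z` is conditionally `σ`-sub-Gaussian given `m`. The exponential moments are required to be
finite, since the conditional expectation of a non-integrable function is `0` in Mathlib. -/
def CondSubGaussian {Ω : Type*} (m : MeasurableSpace Ω) {_mΩ : MeasurableSpace Ω}
    (Z : Ω → ℝ) (σ : ℝ) (μ : Measure Ω) : Prop :=
  ∀ s : ℝ, Integrable (fun ω => Real.exp (s * Z ω)) μ ∧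
    ∀ᵐ ω ∂μ, (μ[fun ω' => Real.exp (s * Z ω') | m]) ω ≤ Real.exp (s ^ 2 * σ ^ 2 / 2)

/-- Conditionally on `m`, the random element `Y` has law `κ ω`. -/
def HasCondLaw {Ω A : Type*} [MeasurableSpace A]
    (m : MeasurableSpace Ω) {_mΩ : MeasurableSpace Ω} (Y : Ω → A) (κ : Ω → Measure A) (μ : Measure Ω) : Prop :=
  ∀ s : Set A, MeasurableSet s →
    μ[(Y ⁻¹' s).indicator (fun _ => (1 : ℝ)) | m] =ᵐ[μ] fun ω => (κ ω).real s

/-! The sequential problem. Rounds are numbered from `0`, so at round `t` there are exactly `t`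
past observations. `D` is the domain of `f`, `S` the search space, `P x` the law of the location
that is actually queried when the target is `x`, `x t` the target of round `t`, `q t` the location
actually queried and `ζ t` the observation noise. -/

section Problem

variable {D : Type*} [MeasurableSpace D] {S : Set D} {Ω : Type*}

/-- `E[f(X)]` for `X ∼ P x`. -/
def expVal (P : Kernel S D) (f : D → ℝ) (x : S) : ℝ := ∫ z, f z ∂(P x)

/-- The observation `y_t = f(q_t) + ζ_t`. -/
def obs (f : D → ℝ) (q : ℕ → Ω → D) (ζ : ℕ → Ω → ℝ) (t : ℕ) (ω : Ω) : ℝ :=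
  f (q t ω) + ζ t ω

/-- The equivalent observation noise `ν_t = y_t - E[f(X_t) | x_t]`. -/
def equivNoise (P : Kernel S D) (f : D → ℝ) (x : ℕ → Ω → S) (q : ℕ → Ω → D) (ζ : ℕ → Ω → ℝ)
    (t : ℕ) (ω : Ω) : ℝ :=
  obs f q ζ t ω - expVal P f (x t ω)

/-- The σ-algebra generated by the targets and equivalent noises of the rounds before `t`. -/
@[reducible] def history (P : Kernel S D) (f : D → ℝ) (x : ℕ → Ω → S) (q : ℕ → Ω → D) (ζ : ℕ → Ω → ℝ)
    (t : ℕ) : MeasurableSpace Ω :=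
  ⨆ i : Fin t, MeasurableSpace.comap
    (fun ω => (x i ω, equivNoise P f x q ζ i ω)) inferInstance

/-- The execution of the queries: given the past, the query at target `x_t` is made at a location
with law `P (x_t)`, independently of the observation noise `ζ_t`. (Having conditional law
`P (x_t)` given the past and `ζ_t` jointly says both.) -/
structure IsNoisyExecution {_mΩ : MeasurableSpace Ω} (μ : Measure Ω) (P : Kernel S D) (f : D → ℝ)
    (x : ℕ → Ω → S) (q : ℕ → Ω → D) (ζ : ℕ → Ω → ℝ) : Prop where
  measurable_query : ∀ t, Measurable (q t)
  measurable_noise : ∀ t, Measurable (ζ t)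
  condLaw : ∀ t, HasCondLaw
    (history P f x q ζ t ⊔ MeasurableSpace.comap (ζ t) inferInstance)
    (q t) (fun ω => P (x t ω)) μ

/-- The targets are selected by the upper confidence bound rule with parameters `lam` and `β`
from the data `(x_i, y_i)`, `i < t`: `x_t` is determined by the past and maximises the upper
confidence bound over `S`. -/
structure IsUCBSelection (k : S → S → ℝ) (lam : ℝ) (β : ℕ → ℝ) (P : Kernel S D) (f : D → ℝ)
    (x : ℕ → Ω → S) (q : ℕ → Ω → D) (ζ : ℕ → Ω → ℝ) : Prop where
  predictable : ∀ t, Measurable[history P f x q ζ t] (x t)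
  maximises : ∀ t ω (x' : S),
    ucb k lam (β t) (fun i : Fin t => x i ω) (fun i : Fin t => obs f q ζ i ω) x' ≤
      ucb k lam (β t) (fun i : Fin t => x i ω) (fun i : Fin t => obs f q ζ i ω) (x t ω)

/-- The uncertain-inputs cumulative regret of the first `n` rounds. -/
def cumRegret (P : Kernel S D) (f : D → ℝ) (x : ℕ → Ω → S) (n : ℕ) (ω : Ω) : ℝ :=
  ∑ t ∈ Finset.range n, ((⨆ x' : S, expVal P f x') - expVal P f (x t ω))

end Problem

end

end UncertainBO

/-! Let `φ` be the feature map of `H_k(S)` and `V = λ + ∑ φ(xᵢ) ⊗ φ(xᵢ)`. The posterior mean is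
`⟨φ(x), V⁻¹ ∑ yᵢ φ(xᵢ)⟩` and the posterior variance is `λ ⟨φ(x), V⁻¹ φ(x)⟩`. Writing `y = g + ν`,
the error of the mean at `x` is at most `σ_t(x)` times `‖g‖` plus the norm of `∑ νᵢ φ(xᵢ)` for
`V⁻¹`, divided by `√λ` (`abs_postMean_sub_le`). So everything rests on bounding this self-normalised
noise.

The uncertain inputs enter only through `ν`. Given the past and `ζ_t`, the location has law `P
(x_t)`; integrating out the location first and `ζ_t` second multiplies two sub-Gaussian factors,
whence `σ_ν² = σ_q² + σ_ζ²` (`subGaussianOn_query_noise`).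

The noise is controlled by the method of mixtures. Formally, `∏ exp (h(xᵢ) νᵢ - σ² h(xᵢ)² / 2)` is
averaged over a Gaussian random function `h` of covariance `k / (λ σ²)`. To avoid a Gaussian measure
on functions, the average is built round by round: the posterior law of `h(x_t)` is a
one-dimensional Gaussian with past-measurable mean and variance, and averaging over it gives a
factor of conditional mean at most `1` (`SubGaussianOn.lintegral_mix_le`). The rank-one updates
`selfNorm_succ` and `det_regGram_succ` identify the product as `exp (selfNorm / (2 σ²)) / √(det (K +
λ) / λ ^ t)`, and Ville's inequality bounds it at all times at once (`measure_selfNorm_le`).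

Half the log-determinant is the mutual information (`mutualInfo_obsLaw`), hence at most `γ_t`. It
also telescopes over the posterior variances, which gives `∑ σ_t² ≤ 4 λ γ_n`, and Cauchy-Schwarz
yields the regret. The `+ 1` in `β` is absorbed only if `γ_n ≥ 1`. If `γ_n < 1`, sampling one point
`n` times shows that `k` is small on the diagonal, and `|g(x)| ≤ ‖g‖ √(k(x,x))` is already enough.
-/

namespace UncertainBO

/-! ### Kernel ridge regression in feature space -/

section Ridge

variable {A E : Type*} [NormedAddCommGroup E] [InnerProductSpace ℝ E]

/-- The regularised empirical covariance operator `u ↦ λ u + ∑ᵢ ⟨φ(xᵢ), u⟩ φ(xᵢ)`. -/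
def ridgeOp (φ : A → E) (lam : ℝ) {n : ℕ} (xs : Fin n → A) (u : E) : E :=
  lam • u + ∑ i, inner ℝ (φ (xs i)) u • φ (xs i)

/-- The regularised Gram matrix `K + λ I`. -/
noncomputable abbrev regGram (k : A → A → ℝ) (lam : ℝ) {n : ℕ} (xs : Fin n → A) :
    Matrix (Fin n) (Fin n) ℝ :=
  gram k xs + lam • (1 : Matrix (Fin n) (Fin n) ℝ)

/-- The solution `u` of `ridgeOp u = v`, written with the regularised Gram matrix. -/
noncomputable def ridgeSol (φ : A → E) (k : A → A → ℝ) (lam : ℝ) {n : ℕ} (xs : Fin n → A)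
    (v : E) : E :=
  lam⁻¹ • (v - ∑ i, ((regGram k lam xs)⁻¹.mulVec fun j => inner ℝ (φ (xs j)) v) i • φ (xs i))

/-- The combination `∑ᵢ cᵢ φ(xᵢ)`. -/
def featSum (φ : A → E) {n : ℕ} (xs : Fin n → A) (c : Fin n → ℝ) : E :=
  ∑ i, c i • φ (xs i)

variable {φ : A → E} {k : A → A → ℝ} {lam : ℝ}

lemma kernel_symm (hk : ∀ x y, inner ℝ (φ x) (φ y) = k x y) (x y : A) : k x y = k y x := by
  rw [← hk, ← hk, real_inner_comm]

lemma gram_isHermitian (hk : ∀ x y, inner ℝ (φ x) (φ y) = k x y) {n : ℕ} (xs : Fin n → A) :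
    (gram k xs).IsHermitian := by
  ext i j
  simp [gram, kernel_symm hk (xs j)]

lemma gram_posSemidef (hk : ∀ x y, inner ℝ (φ x) (φ y) = k x y) {n : ℕ} (xs : Fin n → A) :
    (gram k xs).PosSemidef := by
  refine Matrix.PosSemidef.of_dotProduct_mulVec_nonneg (gram_isHermitian hk xs) fun c => ?_
  have : star c ⬝ᵥ (gram k xs).mulVec c = inner ℝ (featSum φ xs c) (featSum φ xs c) := by
    simp only [featSum, sum_inner, inner_sum, inner_smul_left, inner_smul_right, hk, dotProduct,
      Matrix.mulVec, gram, Matrix.of_apply, Finset.mul_sum]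
    refine Finset.sum_congr rfl fun i _ => Finset.sum_congr rfl fun j _ => ?_
    rw [kernel_symm hk (xs j)]
    simp only [conj_trivial, Pi.star_apply, star_trivial]
    ring
  rw [this]
  exact real_inner_self_nonneg

lemma regGram_posDef (hk : ∀ x y, inner ℝ (φ x) (φ y) = k x y) (hlam : 0 < lam) {n : ℕ}
    (xs : Fin n → A) : (regGram k lam xs).PosDef :=
  Matrix.PosDef.posSemidef_add (gram_posSemidef hk xs) (Matrix.PosDef.one.smul hlam)

lemma isUnit_regGram (hk : ∀ x y, inner ℝ (φ x) (φ y) = k x y) (hlam : 0 < lam) {n : ℕ}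
    (xs : Fin n → A) : IsUnit (regGram k lam xs).det :=
  (regGram_posDef hk hlam xs).det_pos.ne'.isUnit

/-- The push-through identity `Φ V⁻¹ = (K + λ)⁻¹ Φ`, with `Φ` the evaluation of features at the
sample points. It makes `ridgeSol` an explicit inverse of `ridgeOp` without any operator theory. -/
lemma inner_feature_ridgeSol (hk : ∀ x y, inner ℝ (φ x) (φ y) = k x y) (hlam : 0 < lam) {n : ℕ}
    (xs : Fin n → A) (v : E) (i : Fin n) :
    inner ℝ (φ (xs i)) (ridgeSol φ k lam xs v) =
      ((regGram k lam xs)⁻¹.mulVec fun j => inner ℝ (φ (xs j)) v) i := by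
  set w := (regGram k lam xs)⁻¹.mulVec fun j => inner ℝ (φ (xs j)) v with hw
  have h : (regGram k lam xs).mulVec w = fun j => inner ℝ (φ (xs j)) v := by
    rw [hw, Matrix.mulVec_mulVec, Matrix.mul_nonsing_inv _ (isUnit_regGram hk hlam xs),
      Matrix.one_mulVec]
  have hi := congrFun h i
  rw [Matrix.add_mulVec, Pi.add_apply, Matrix.smul_mulVec, Matrix.one_mulVec, Pi.smul_apply,
    smul_eq_mul] at hi
  rw [ridgeSol, inner_smul_right, inner_sub_right, inner_sum, ← hw, ← hi]
  have : ∑ j, inner ℝ (φ (xs i)) (w j • φ (xs j)) = (gram k xs).mulVec w i := by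
    simp [inner_smul_right, hk, Matrix.mulVec, dotProduct, gram, mul_comm]
  rw [this]
  field_simp
  ring

lemma ridgeOp_ridgeSol (hk : ∀ x y, inner ℝ (φ x) (φ y) = k x y) (hlam : 0 < lam) {n : ℕ}
    (xs : Fin n → A) (v : E) : ridgeOp φ lam xs (ridgeSol φ k lam xs v) = v := by
  rw [ridgeOp]
  simp_rw [inner_feature_ridgeSol hk hlam]
  rw [ridgeSol, smul_smul, mul_inv_cancel₀ hlam.ne', one_smul, sub_add_cancel]

lemma inner_ridgeOp {n : ℕ} (xs : Fin n → A) (u v : E) :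
    inner ℝ (ridgeOp φ lam xs u) v =
      lam * inner ℝ u v + ∑ i, inner ℝ (φ (xs i)) u * inner ℝ (φ (xs i)) v := by
  simp [ridgeOp, inner_add_left, inner_smul_left, sum_inner]

lemma inner_ridgeOp_comm {n : ℕ} (xs : Fin n → A) (u v : E) :
    inner ℝ (ridgeOp φ lam xs u) v = inner ℝ u (ridgeOp φ lam xs v) := by
  rw [real_inner_comm (ridgeOp φ lam xs v) u, inner_ridgeOp, inner_ridgeOp, real_inner_comm]
  simp [mul_comm]

lemma ridgeOp_add {n : ℕ} (xs : Fin n → A) (u v : E) :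
    ridgeOp φ lam xs (u + v) = ridgeOp φ lam xs u + ridgeOp φ lam xs v := by
  simp only [ridgeOp, smul_add, inner_add_right, add_smul, Finset.sum_add_distrib]
  abel

lemma ridgeOp_smul {n : ℕ} (xs : Fin n → A) (c : ℝ) (u : E) :
    ridgeOp φ lam xs (c • u) = c • ridgeOp φ lam xs u := by
  simp only [ridgeOp, smul_add, inner_smul_right, Finset.smul_sum, smul_smul, mul_comm]

lemma mul_norm_sq_le_inner_ridgeOp {n : ℕ} (xs : Fin n → A) (u : E) :
    lam * ‖u‖ ^ 2 ≤ inner ℝ (ridgeOp φ lam xs u) u := by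
  rw [inner_ridgeOp, real_inner_self_eq_norm_sq]
  have : 0 ≤ ∑ i, inner ℝ (φ (xs i)) u * inner ℝ (φ (xs i)) u :=
    Finset.sum_nonneg fun i _ => mul_self_nonneg _
  linarith

lemma ridgeOp_injective (hlam : 0 < lam) {n : ℕ} (xs : Fin n → A) :
    Function.Injective (ridgeOp φ lam xs) := by
  intro u v h
  have h1 : ridgeOp φ lam xs (u + (-1 : ℝ) • v) = 0 := by
    rw [ridgeOp_add, ridgeOp_smul, h]; simp
  have h2 := mul_norm_sq_le_inner_ridgeOp (φ := φ) (lam := lam) xs (u + (-1 : ℝ) • v)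
  rw [h1, inner_zero_left] at h2
  have h3 : ‖u + (-1 : ℝ) • v‖ ^ 2 = 0 := by
    have := sq_nonneg ‖u + (-1 : ℝ) • v‖
    nlinarith
  have h4 : u + (-1 : ℝ) • v = 0 := by simpa using h3
  rw [neg_one_smul, ← sub_eq_add_neg, sub_eq_zero] at h4
  exact h4

/-- Cauchy-Schwarz for the form `⟨ridgeOp u, v⟩`. -/
lemma inner_ridgeOp_sq_le (hlam : 0 < lam) {n : ℕ} (xs : Fin n → A) (u v : E) :
    inner ℝ (ridgeOp φ lam xs u) v ^ 2 ≤
      inner ℝ (ridgeOp φ lam xs u) u * inner ℝ (ridgeOp φ lam xs v) v := by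
  have hpos : ∀ w : E, 0 ≤ inner ℝ (ridgeOp φ lam xs w) w := fun w =>
    (mul_nonneg hlam.le (sq_nonneg _)).trans (mul_norm_sq_le_inner_ridgeOp xs w)
  have h : ∀ t : ℝ, 0 ≤ inner ℝ (ridgeOp φ lam xs v) v * (t * t) +
      2 * inner ℝ (ridgeOp φ lam xs u) v * t + inner ℝ (ridgeOp φ lam xs u) u := by
    intro t
    have := hpos (u + t • v)
    have hc : inner ℝ (ridgeOp φ lam xs v) u = inner ℝ (ridgeOp φ lam xs u) v := by
      rw [inner_ridgeOp_comm, real_inner_comm]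
    simp only [ridgeOp_add, ridgeOp_smul, inner_add_left, inner_add_right, inner_smul_left,
      inner_smul_right, hc, conj_trivial] at this
    linarith
  have := discrim_le_zero h
  rw [discrim] at this
  linarith

lemma inner_ridgeSol_comm (hk : ∀ x y, inner ℝ (φ x) (φ y) = k x y) (hlam : 0 < lam) {n : ℕ}
    (xs : Fin n → A) (u v : E) :
    inner ℝ u (ridgeSol φ k lam xs v) = inner ℝ (ridgeSol φ k lam xs u) v := by
  conv_lhs => rw [← ridgeOp_ridgeSol hk hlam xs u]
  rw [inner_ridgeOp_comm, ridgeOp_ridgeSol hk hlam]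

lemma inner_ridgeSol_feature (hk : ∀ x y, inner ℝ (φ x) (φ y) = k x y) {n : ℕ}
    (xs : Fin n → A) (x : A) :
    inner ℝ (φ x) (ridgeSol φ k lam xs (φ x)) = postVar k lam xs x / lam := by
  have h : (fun j => k (xs j) x) = covVec k xs x := by
    ext j; rw [covVec, kernel_symm hk]
  rw [ridgeSol, inner_smul_right, inner_sub_right, inner_sum]
  simp only [inner_smul_right, hk, h]
  rw [postVar, div_eq_inv_mul]
  congr 2
  simp [dotProduct, covVec, mul_comm]

lemma postMean_eq_inner_ridgeSol (hk : ∀ x y, inner ℝ (φ x) (φ y) = k x y) (hlam : 0 < lam)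
    {n : ℕ} (xs : Fin n → A) (ys : Fin n → ℝ) (x : A) :
    postMean k lam xs ys x = inner ℝ (φ x) (ridgeSol φ k lam xs (featSum φ xs ys)) := by
  have h : (fun j => k (xs j) x) = covVec k xs x := by
    ext j; rw [covVec, kernel_symm hk]
  have hs : (regGram k lam xs)⁻¹.transpose = (regGram k lam xs)⁻¹ := by
    have := (regGram_posDef hk hlam xs).isHermitian.inv
    simpa [Matrix.IsHermitian, Matrix.conjTranspose_eq_transpose_of_trivial] using this
  rw [inner_ridgeSol_comm hk hlam, featSum, inner_sum]
  simp only [inner_smul_right]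
  simp_rw [fun i => real_inner_comm (φ (xs i)) (ridgeSol φ k lam xs (φ x)),
    inner_feature_ridgeSol hk hlam, hk, h]
  rw [postMean, Matrix.dotProduct_mulVec, ← Matrix.mulVec_transpose, hs]
  simp [dotProduct, mul_comm]

lemma postVar_nonneg (hk : ∀ x y, inner ℝ (φ x) (φ y) = k x y) (hlam : 0 < lam) {n : ℕ}
    (xs : Fin n → A) (x : A) : 0 ≤ postVar k lam xs x := by
  have h1 := mul_norm_sq_le_inner_ridgeOp (φ := φ) (lam := lam) xs (ridgeSol φ k lam xs (φ x))
  rw [ridgeOp_ridgeSol hk hlam, inner_ridgeSol_feature hk] at h1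
  have h2 : 0 ≤ postVar k lam xs x / lam := le_trans (by positivity) h1
  exact by simpa [hlam.ne'] using mul_nonneg h2 hlam.le

lemma postVar_le (hk : ∀ x y, inner ℝ (φ x) (φ y) = k x y) (hlam : 0 < lam) {n : ℕ}
    (xs : Fin n → A) (x : A) : postVar k lam xs x ≤ k x x := by
  have := (regGram_posDef hk hlam xs).inv.posSemidef.dotProduct_mulVec_nonneg (covVec k xs x)
  rw [star_trivial] at this
  rw [postVar]
  exact sub_le_self _ this

/-- The squared norm of `∑ᵢ cᵢ φ(xᵢ)` for the inverse of the regularised covariance operator. -/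
noncomputable def selfNorm (φ : A → E) (k : A → A → ℝ) (lam : ℝ) {n : ℕ} (xs : Fin n → A)
    (c : Fin n → ℝ) : ℝ :=
  inner ℝ (featSum φ xs c) (ridgeSol φ k lam xs (featSum φ xs c))

lemma selfNorm_nonneg (hk : ∀ x y, inner ℝ (φ x) (φ y) = k x y) (hlam : 0 < lam) {n : ℕ}
    (xs : Fin n → A) (c : Fin n → ℝ) : 0 ≤ selfNorm φ k lam xs c := by
  have h1 := mul_norm_sq_le_inner_ridgeOp (φ := φ) (lam := lam) xs
    (ridgeSol φ k lam xs (featSum φ xs c))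
  rw [ridgeOp_ridgeSol hk hlam] at h1
  exact le_trans (by positivity) h1

lemma ridgeOp_succ {n : ℕ} (xs : Fin (n + 1) → A) (u : E) :
    ridgeOp φ lam xs u = ridgeOp φ lam (fun i : Fin n => xs i.castSucc) u +
      inner ℝ (φ (xs (Fin.last n))) u • φ (xs (Fin.last n)) := by
  rw [ridgeOp, ridgeOp, Fin.sum_univ_castSucc, add_assoc]

/-- The rank-one update of `selfNorm`. -/
lemma selfNorm_succ (hk : ∀ x y, inner ℝ (φ x) (φ y) = k x y) (hlam : 0 < lam) {n : ℕ}
    (xs : Fin (n + 1) → A) (c : Fin (n + 1) → ℝ) (a b : ℝ)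
    (ha : a = postVar k lam (fun i : Fin n => xs i.castSucc) (xs (Fin.last n)) / lam)
    (hb : b = postMean k lam (fun i : Fin n => xs i.castSucc) (fun i : Fin n => c i.castSucc)
      (xs (Fin.last n))) :
    selfNorm φ k lam xs c =
      selfNorm φ k lam (fun i : Fin n => xs i.castSucc) (fun i : Fin n => c i.castSucc) +
        (a * c (Fin.last n) ^ 2 + 2 * b * c (Fin.last n) - b ^ 2) / (1 + a) := by
  set xs' := fun i : Fin n => xs i.castSucc
  set c' := fun i : Fin n => c i.castSucc
  set x := xs (Fin.last n)
  set y := c (Fin.last n)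
  have ha0 : 0 ≤ a := by rw [ha]; exact div_nonneg (postVar_nonneg hk hlam _ _) hlam.le
  have ha1 : 1 + a ≠ 0 := by positivity
  set S := featSum φ xs' c' with hS
  set s := ridgeSol φ k lam xs' S with hs
  set p := ridgeSol φ k lam xs' (φ x) with hp
  have hfs : featSum φ xs c = S + y • φ x := by
    rw [featSum, Fin.sum_univ_castSucc]; rfl
  have hVs : ridgeOp φ lam xs' s = S := ridgeOp_ridgeSol hk hlam _ _
  have hVp : ridgeOp φ lam xs' p = φ x := ridgeOp_ridgeSol hk hlam _ _
  have hap : inner ℝ (φ x) p = a := by rw [ha, hp, inner_ridgeSol_feature hk]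
  have hbs : inner ℝ (φ x) s = b := by rw [hb, hs, postMean_eq_inner_ridgeSol hk hlam]
  have hSp : inner ℝ S p = b := by
    rw [hp, inner_ridgeSol_comm hk hlam, ← hs, real_inner_comm, hbs]
  -- Sherman-Morrison: the new operator sends `s + c p` to `S + (c + b + c a) φ(x)`, and `c + b + c
  -- a = y` forces `c = (y - b) / (1 + a)`.
  have hsol : ridgeSol φ k lam xs (featSum φ xs c) = s + ((y - b) / (1 + a)) • p := by
    apply ridgeOp_injective (φ := φ) hlam xs
    rw [ridgeOp_ridgeSol hk hlam, hfs, ridgeOp_succ, ridgeOp_add, ridgeOp_smul]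
    change _ = ridgeOp φ lam xs' s + _ • ridgeOp φ lam xs' p + inner ℝ (φ x) _ • φ x
    rw [hVs, hVp, inner_add_right, inner_smul_right, hap, hbs, add_assoc, ← add_smul]
    congr 2
    field_simp
    ring
  rw [selfNorm, hsol, hfs]
  simp only [inner_add_left, inner_add_right, inner_smul_left, inner_smul_right, hap, hbs, hSp,
    conj_trivial]
  rw [show selfNorm φ k lam xs' c' = inner ℝ S s from rfl]
  field_simp
  ring

/-- The Schur complement of the old block in the bordered matrix is exactly `λ` plus the posterior
variance at the new point. -/
lemma det_regGram_succ (hk : ∀ x y, inner ℝ (φ x) (φ y) = k x y) (hlam : 0 < lam) {n : ℕ}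
    (xs : Fin (n + 1) → A) :
    (regGram k lam xs).det = (regGram k lam (fun i : Fin n => xs i.castSucc)).det *
      (lam + postVar k lam (fun i : Fin n => xs i.castSucc) (xs (Fin.last n))) := by
  set xs' := fun i : Fin n => xs i.castSucc
  set x := xs (Fin.last n)
  have hM : (regGram k lam xs).submatrix finSumFinEquiv finSumFinEquiv =
      Matrix.fromBlocks (regGram k lam xs') (Matrix.of fun i (_ : Fin 1) => k (xs' i) x)
        (Matrix.of fun (_ : Fin 1) j => k x (xs' j)) (Matrix.of fun _ _ : Fin 1 => k x x + lam) := by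
    ext i j
    rcases i with i | i <;> rcases j with j | j
    · simp only [Matrix.submatrix_apply, finSumFinEquiv_apply_left, Matrix.fromBlocks_apply₁₁,
        Matrix.add_apply, Matrix.smul_apply, Matrix.one_apply, gram, Matrix.of_apply]
      simp [xs', Fin.ext_iff]
      rfl
    · have h1 : (Fin.castAdd 1 i) ≠ Fin.last n := by
        simp only [ne_eq, Fin.ext_iff, Fin.val_castAdd, Fin.val_last]; omega
      have h2 : Fin.natAdd n j = Fin.last n := by ext; simp
      simp only [Matrix.submatrix_apply, finSumFinEquiv_apply_left, finSumFinEquiv_apply_right,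
        Matrix.fromBlocks_apply₁₂, Matrix.add_apply, Matrix.smul_apply, Matrix.one_apply, gram,
        Matrix.of_apply, h2, if_neg h1]
      simp [xs', x]
      rfl
    · have h1 : Fin.last n ≠ (Fin.castAdd 1 j) := by
        simp only [ne_eq, Fin.ext_iff, Fin.val_castAdd, Fin.val_last]; omega
      have h2 : Fin.natAdd n i = Fin.last n := by ext; simp
      simp only [Matrix.submatrix_apply, finSumFinEquiv_apply_left, finSumFinEquiv_apply_right,
        Matrix.fromBlocks_apply₂₁, Matrix.add_apply, Matrix.smul_apply, Matrix.one_apply, gram,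
        Matrix.of_apply, h2, if_neg h1]
      simp [xs', x]
      rfl
    · have h2 : ∀ i : Fin 1, Fin.natAdd n i = Fin.last n := fun i => by ext; simp
      simp [h2, gram, x]
  have := (regGram k lam xs').invertibleOfIsUnitDet (isUnit_regGram hk hlam xs')
  rw [← Matrix.det_submatrix_equiv_self finSumFinEquiv, hM, Matrix.det_fromBlocks₁₁,
    Matrix.det_fin_one, Matrix.invOf_eq_nonsing_inv]
  congr 1
  rw [Matrix.sub_apply, Matrix.mul_assoc, postVar]
  have h : (fun i => k (xs' i) x) = covVec k xs' x := by
    ext j; rw [covVec, kernel_symm hk]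
  have h2 : (Matrix.of fun i (_ : Fin 1) => k (xs' i) x) = Matrix.of fun i (_ : Fin 1) => covVec k xs' x i := by
    ext i j; exact congrFun h i
  rw [h2]
  simp only [Matrix.of_apply, Matrix.mul_apply, dotProduct, Matrix.mulVec, covVec]
  ring

/-- The deviation of the posterior mean from the target, in terms of the self-normalised noise. -/
lemma abs_postMean_sub_le (hk : ∀ x y, inner ℝ (φ x) (φ y) = k x y) (hlam : 0 < lam) {n : ℕ}
    (xs : Fin n → A) (ys ν : Fin n → ℝ) (g : E) (hy : ∀ i, ys i = inner ℝ (φ (xs i)) g + ν i)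
    (x : A) :
    |postMean k lam xs ys x - inner ℝ (φ x) g| ≤
      (‖g‖ + √(selfNorm φ k lam xs ν / lam)) * √(postVar k lam xs x) := by
  set p := ridgeSol φ k lam xs (φ x) with hp
  set s := ridgeSol φ k lam xs (featSum φ xs ν) with hs
  have hVp : ridgeOp φ lam xs p = φ x := ridgeOp_ridgeSol hk hlam _ _
  have hVs : ridgeOp φ lam xs s = featSum φ xs ν := ridgeOp_ridgeSol hk hlam _ _
  have hpp : inner ℝ (ridgeOp φ lam xs p) p = postVar k lam xs x / lam := by
    rw [hVp, hp, inner_ridgeSol_feature hk]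
  have hss : inner ℝ (ridgeOp φ lam xs s) s = selfNorm φ k lam xs ν := by
    rw [hVs, selfNorm, hs]
  have hv0 := postVar_nonneg hk hlam xs x
  -- The data equal `V g - λ g` plus the noise sum. Applying `V⁻¹` splits the error into a
  -- regularisation bias `-λ ⟨p, g⟩` and a noise term, the latter bounded by Cauchy-Schwarz for `V`.
  have hfs : featSum φ xs ys = ridgeOp φ lam xs g - lam • g + featSum φ xs ν := by
    simp only [featSum, ridgeOp, hy, add_smul, Finset.sum_add_distrib, add_sub_cancel_left]
  have key : postMean k lam xs ys x - inner ℝ (φ x) g =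
      - (lam * inner ℝ p g) + inner ℝ (ridgeOp φ lam xs p) s := by
    rw [postMean_eq_inner_ridgeSol hk hlam, inner_ridgeSol_comm hk hlam, ← hp, hfs,
      inner_add_right, inner_sub_right, inner_smul_right, ← inner_ridgeOp_comm, hVp, ← hVs,
      ← inner_ridgeOp_comm, hVp]
    ring
  rw [key]
  have h1 : |lam * inner ℝ p g| ≤ ‖g‖ * √(postVar k lam xs x) := by
    rw [abs_mul, abs_of_pos hlam]
    have h2 : lam * ‖p‖ ≤ √(postVar k lam xs x) := by
      apply Real.le_sqrt_of_sq_le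
      have := mul_norm_sq_le_inner_ridgeOp (φ := φ) (lam := lam) xs p
      rw [hpp, le_div_iff₀ hlam] at this
      nlinarith
    calc lam * |inner ℝ p g| ≤ lam * (‖p‖ * ‖g‖) := by gcongr; exact abs_real_inner_le_norm _ _
      _ = ‖g‖ * (lam * ‖p‖) := by ring
      _ ≤ _ := by gcongr
  have h2 : |inner ℝ (ridgeOp φ lam xs p) s| ≤
      √(selfNorm φ k lam xs ν / lam) * √(postVar k lam xs x) := by
    rw [← Real.sqrt_mul (div_nonneg (selfNorm_nonneg hk hlam xs ν) hlam.le)]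
    apply Real.le_sqrt_of_sq_le
    rw [sq_abs]
    refine (inner_ridgeOp_sq_le hlam xs p s).trans_eq ?_
    rw [hpp, hss]
    ring
  calc _ ≤ |-(lam * inner ℝ p g)| + |inner ℝ (ridgeOp φ lam xs p) s| := abs_add_le _ _
    _ ≤ _ := by rw [abs_neg]; linarith [add_mul ‖g‖ (√(selfNorm φ k lam xs ν / lam)) (√(postVar k lam xs x))]

end Ridge

/-! ### Mutual information of a Gaussian channel -/

section GaussianInformation

variable {E : Type*} [NormedAddCommGroup E] [InnerProductSpace ℝ E]

/-- The density of the standard Gaussian measure. -/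
noncomputable def stdGaussianDensity (x : E) : ℝ :=
  (2 * Real.pi) ^ (-(Module.finrank ℝ E / 2 : ℝ)) * Real.exp (-(1 / 2) * ‖x‖ ^ 2)

lemma stdGaussianDensity_pos (x : E) : 0 < stdGaussianDensity x := by
  unfold stdGaussianDensity; positivity

variable [MeasurableSpace E] [BorelSpace E]

@[fun_prop]
lemma measurable_stdGaussianDensity : Measurable (stdGaussianDensity (E := E)) := by
  unfold stdGaussianDensity; fun_prop

variable [FiniteDimensional ℝ E]

lemma integrable_stdGaussianDensity : Integrable (stdGaussianDensity (E := E)) := by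
  have h := GaussianFourier.integrable_cexp_neg_mul_sq_norm_add (b := (1 / 2 : ℂ)) (by norm_num) 0
    (0 : E)
  have h2 : Integrable (fun x : E => Real.exp (-(1 / 2) * ‖x‖ ^ 2)) := by
    convert h.re using 2 with x
    rw [zero_mul, add_zero, show (-(1 / 2 : ℂ) * (‖x‖ : ℂ) ^ 2) = ((-(1 / 2) * ‖x‖ ^ 2 : ℝ) : ℂ) by
      push_cast; ring, ← Complex.ofReal_exp]
    rfl
  exact h2.const_mul _

lemma stdGaussian_eq_withDensity :
    stdGaussian E = volume.withDensity fun x => ENNReal.ofReal (stdGaussianDensity x) := by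
  have hfin : IsFiniteMeasure
      ((volume : Measure E).withDensity fun x => ENNReal.ofReal (stdGaussianDensity x)) :=
    isFiniteMeasure_withDensity_ofReal integrable_stdGaussianDensity.2
  refine Measure.ext_of_charFun ?_
  ext t
  rw [charFun_stdGaussian, charFun_apply,
    integral_withDensity_eq_integral_toReal_smul (by fun_prop) (by simp)]
  have h := GaussianFourier.integral_cexp_neg_mul_sq_norm_add (b := (1 / 2 : ℂ)) (by norm_num)
    Complex.I t
  have h2 : ∀ x : E, (ENNReal.ofReal (stdGaussianDensity x)).toReal •
      Complex.exp (inner ℝ x t * Complex.I) =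
      (((2 * Real.pi) ^ (-(Module.finrank ℝ E / 2 : ℝ)) : ℝ) : ℂ) *
        Complex.exp (-(1 / 2) * ‖x‖ ^ 2 + Complex.I * inner ℝ t x) := by
    intro x
    rw [ENNReal.toReal_ofReal (stdGaussianDensity_pos x).le, stdGaussianDensity, Complex.real_smul,
      Complex.exp_add, real_inner_comm x t]
    push_cast
    ring_nf
  simp_rw [h2]
  rw [integral_const_mul, h]
  have h3 : (Real.pi / (1 / 2 : ℂ)) ^ (Module.finrank ℝ E / 2 : ℂ) =
      (((2 * Real.pi) ^ (Module.finrank ℝ E / 2 : ℝ) : ℝ) : ℂ) := by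
    rw [Complex.ofReal_cpow (by positivity)]
    push_cast
    congr 1
    field_simp
  rw [h3, ← mul_assoc, ← Complex.ofReal_mul, ← Real.rpow_add (by positivity), neg_add_cancel,
    Real.rpow_zero, Complex.ofReal_one, one_mul]
  congr 1
  rw [Complex.I_sq]
  ring

lemma lintegral_affine_stdGaussian (A : E ≃L[ℝ] E) (m : E) {h : E → ℝ≥0∞} (hh : Measurable h) :
    ∫⁻ z, h (m + A z) ∂(stdGaussian E) =
      ∫⁻ x, ENNReal.ofReal (|LinearMap.det (A : E →ₗ[ℝ] E)|⁻¹ *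
        stdGaussianDensity (A.symm (x - m))) * h x := by
  have hdet : LinearMap.det (A : E →ₗ[ℝ] E) ≠ 0 := (LinearEquiv.isUnit_det' A.toLinearEquiv).ne_zero
  rw [stdGaussian_eq_withDensity, lintegral_withDensity_eq_lintegral_mul _ (by fun_prop)
    (by fun_prop)]
  set G : E → ℝ≥0∞ := fun x => ENNReal.ofReal (stdGaussianDensity (A.symm (x - m))) * h x with hG
  have hGm : Measurable G := by fun_prop
  have h1 : ∀ z, ((fun x : E => ENNReal.ofReal (stdGaussianDensity x)) * fun z => h (m + A z)) z =
      G (m + A z) := by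
    intro z; simp [hG]
  simp_rw [h1, ENNReal.ofReal_mul (inv_nonneg.2 (abs_nonneg _)), mul_assoc]
  have h2 : ∫⁻ z, G (m + A z) =
      ∫⁻ x, G (m + x) ∂(Measure.map (A : E →ₗ[ℝ] E) volume) := by
    rw [lintegral_map (by fun_prop) (by change Measurable (fun x => A x); fun_prop)]
    rfl
  rw [h2, Measure.map_linearMap_addHaar_eq_smul_addHaar _ hdet, lintegral_smul_measure,
    lintegral_add_left_eq_self, lintegral_const_mul _ hGm, abs_inv, smul_eq_mul]

/-- The mutual information of a linear Gaussian channel with arbitrary input and Gaussian output. -/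
lemma mutualInfo_gaussian_channel (A B : E ≃L[ℝ] E) (P : Measure E) [IsProbabilityMeasure P]
    (ρ : Measure (E × E))
    (hρ : ρ = (P.prod (stdGaussian E)).map fun p => (p.1 + B p.2, p.1))
    (hfst : ρ.fst = (stdGaussian E).map A) :
    mutualInfo ρ = ENNReal.ofReal (Real.log |LinearMap.det (A : E →ₗ[ℝ] E)| -
      Real.log |LinearMap.det (B : E →ₗ[ℝ] E)|) := by
  have hmeas : Measurable fun p : E × E => (p.1 + B p.2, p.1) := by fun_prop
  have hdA : 0 < |LinearMap.det (A : E →ₗ[ℝ] E)| :=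
    abs_pos.2 (LinearEquiv.isUnit_det' A.toLinearEquiv).ne_zero
  have hdB : 0 < |LinearMap.det (B : E →ₗ[ℝ] E)| :=
    abs_pos.2 (LinearEquiv.isUnit_det' B.toLinearEquiv).ne_zero
  set dA := |LinearMap.det (A : E →ₗ[ℝ] E)|
  set dB := |LinearMap.det (B : E →ₗ[ℝ] E)|
  have hprob : IsProbabilityMeasure ρ := by
    rw [hρ]; exact Measure.isProbabilityMeasure_map hmeas.aemeasurable
  have hsnd : ρ.snd = P := by
    rw [hρ, Measure.snd, Measure.map_map measurable_snd hmeas]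
    change (P.prod _).map Prod.fst = P
    simp
  set Q := (stdGaussian E).map A with hQ
  have hQp : IsProbabilityMeasure Q :=
    Measure.isProbabilityMeasure_map (by fun_prop)
  -- The ratio at `y` of the density of `g + B z` for fixed `g` to that of `A z`. No density of the
  -- input is needed, so a degenerate law of `g` is allowed.
  set F : E × E → ℝ := fun p => dA / dB *
    Real.exp (‖A.symm p.1‖ ^ 2 / 2 - ‖B.symm (p.1 - p.2)‖ ^ 2 / 2) with hF
  have hFm : Measurable F := by fun_prop
  have hFpos : ∀ p, 0 < F p := fun p => by positivity
  have hdens : ρ = (Q.prod P).withDensity fun p => ENNReal.ofReal (F p) := by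
    refine Measure.ext_of_lintegral _ fun h hh => ?_
    rw [hρ, lintegral_map hh hmeas, lintegral_withDensity_eq_lintegral_mul _ (by fun_prop) hh,
      lintegral_prod _ (by fun_prop), lintegral_prod_symm _ (by fun_prop)]
    refine lintegral_congr fun g => ?_
    have e1 := lintegral_affine_stdGaussian B g (h := fun y => h (y, g)) (by fun_prop)
    rw [e1, hQ, lintegral_map (by fun_prop) (by fun_prop)]
    have e2 := lintegral_affine_stdGaussian A 0
      (h := fun y => ENNReal.ofReal (F (y, g)) * h (y, g)) (by fun_prop)
    simp only [zero_add, sub_zero] at e2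
    simp only [Pi.mul_apply]
    rw [e2]
    refine lintegral_congr fun y => ?_
    rw [← mul_assoc, ← ENNReal.ofReal_mul (by have := stdGaussianDensity_pos (A.symm y); positivity)]
    congr 2
    simp only [hF, stdGaussianDensity]
    have : Real.exp (-(1 / 2) * ‖B.symm (y - g)‖ ^ 2) = Real.exp (-(1 / 2) * ‖A.symm y‖ ^ 2) *
        Real.exp (‖A.symm y‖ ^ 2 / 2 - ‖B.symm (y - g)‖ ^ 2 / 2) := by
      rw [← Real.exp_add]; congr 1; ring
    rw [this]
    field_simp
    exact (div_self hdB.ne').trans (div_self hdA.ne').symm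
  have hac : ρ ≪ Q.prod P := by
    rw [hdens]; exact withDensity_absolutelyContinuous _ _
  have hllr : llr ρ (Q.prod P) =ᵐ[ρ] fun p =>
      (Real.log dA - Real.log dB) + (‖A.symm p.1‖ ^ 2 / 2 - ‖B.symm (p.1 - p.2)‖ ^ 2 / 2) := by
    refine hac.ae_eq ?_
    have h1 := Measure.rnDeriv_withDensity (Q.prod P) (f := fun p => ENNReal.ofReal (F p))
      (by fun_prop)
    rw [← hdens] at h1
    filter_upwards [h1] with p hp
    rw [llr, hp, ENNReal.toReal_ofReal (hFpos p).le, hF,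
      Real.log_mul (by positivity) (Real.exp_pos _).ne', Real.log_div hdA.ne' hdB.ne', Real.log_exp]
  have hint : Integrable (fun z : E => ‖z‖ ^ 2 / 2) (stdGaussian E) :=
    (IsGaussian.memLp_two_id (μ := stdGaussian E)).integrable_norm_pow (by norm_num) |>.div_const 2
  have hmA : Measurable fun p : E × E => A.symm p.1 := by fun_prop
  have hmB : Measurable fun p : E × E => B.symm (p.1 - p.2) := by fun_prop
  -- Under `ρ` both quadratic terms of the log-likelihood ratio are half the squared norm of a
  -- standard Gaussian vector, so their expectations cancel and only the log-determinants survive.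
  have hA : ρ.map (fun p => A.symm p.1) = stdGaussian E := by
    have : (fun p : E × E => A.symm p.1) = A.symm ∘ Prod.fst := rfl
    rw [this, ← Measure.map_map (by fun_prop) measurable_fst]
    change ρ.fst.map _ = _
    rw [hfst, hQ, Measure.map_map (by fun_prop) (by fun_prop)]
    simp
  have hB : ρ.map (fun p => B.symm (p.1 - p.2)) = stdGaussian E := by
    rw [hρ, Measure.map_map hmB hmeas]
    have : (fun p : E × E => B.symm (p.1 - p.2)) ∘ (fun p : E × E => (p.1 + B p.2, p.1)) =
        Prod.snd := by
      ext p; simp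
    rw [this]
    simp
  have hiA : Integrable (fun p : E × E => ‖A.symm p.1‖ ^ 2 / 2) ρ := by
    rw [← hA] at hint; exact hint.comp_measurable hmA
  have hiB : Integrable (fun p : E × E => ‖B.symm (p.1 - p.2)‖ ^ 2 / 2) ρ := by
    rw [← hB] at hint; exact hint.comp_measurable hmB
  have hiAB : Integrable
      (fun p : E × E => ‖A.symm p.1‖ ^ 2 / 2 - ‖B.symm (p.1 - p.2)‖ ^ 2 / 2) ρ := hiA.sub hiB
  have heA : ∫ p, ‖A.symm p.1‖ ^ 2 / 2 ∂ρ = ∫ z, ‖z‖ ^ 2 / 2 ∂(stdGaussian E) := by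
    rw [← hA, integral_map hmA.aemeasurable (by fun_prop)]
  have heB : ∫ p, ‖B.symm (p.1 - p.2)‖ ^ 2 / 2 ∂ρ = ∫ z, ‖z‖ ^ 2 / 2 ∂(stdGaussian E) := by
    rw [← hB, integral_map hmB.aemeasurable (by fun_prop)]
  rw [mutualInfo, hfst, hsnd, InformationTheory.klDiv_of_ac_of_integrable hac
    (((integrable_const _).add hiAB).congr hllr.symm), integral_congr_ae hllr,
    integral_add (integrable_const _) hiAB, integral_sub hiA hiB, heA, heB]
  simp

end GaussianInformation

/-! ### Information gain as a log-determinant -/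

section InfoGain

variable {A E : Type*} [NormedAddCommGroup E] [InnerProductSpace ℝ E]
  {φ : A → E} {k : A → A → ℝ} {lam : ℝ}

open scoped MatrixOrder in
lemma sq_det_cfc_sqrt {n : ℕ} {M : Matrix (Fin n) (Fin n) ℝ} (hM : M.PosSemidef) :
    (CFC.sqrt M).det ^ 2 = M.det := by
  rw [sq, ← Matrix.det_mul, CFC.sqrt_mul_sqrt_self M hM.nonneg]

-- The map is the positive square root of `M`, whose determinant squares to `M.det`; hence the
-- factor `1 / 2`.
open scoped MatrixOrder in
lemma exists_equiv_multivariateGaussian {n : ℕ} {M : Matrix (Fin n) (Fin n) ℝ} (hM : M.PosDef) :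
    ∃ L : EuclideanSpace ℝ (Fin n) ≃L[ℝ] EuclideanSpace ℝ (Fin n),
      multivariateGaussian 0 M = (stdGaussian _).map L ∧
      Real.log |LinearMap.det (L : EuclideanSpace ℝ (Fin n) →ₗ[ℝ] EuclideanSpace ℝ (Fin n))| =
        Real.log M.det / 2 := by
  set T := Matrix.toEuclideanCLM (n := Fin n) (𝕜 := ℝ) (CFC.sqrt M) with hT
  have hsq := sq_det_cfc_sqrt hM.posSemidef
  have hdet : LinearMap.det (T : EuclideanSpace ℝ (Fin n) →ₗ[ℝ] EuclideanSpace ℝ (Fin n)) =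
      (CFC.sqrt M).det := by
    rw [hT, Matrix.coe_toEuclideanCLM_eq_toEuclideanLin, Matrix.toEuclideanLin_eq_toLin_orthonormal,
      LinearMap.det_toLin]
  have hne : (CFC.sqrt M).det ≠ 0 := by
    intro h
    rw [h] at hsq
    have := hM.det_pos
    rw [← hsq] at this
    simp at this
  have hT0 : T.det ≠ 0 := by
    change LinearMap.det (T : EuclideanSpace ℝ (Fin n) →ₗ[ℝ] EuclideanSpace ℝ (Fin n)) ≠ 0
    rwa [hdet]
  refine ⟨T.toContinuousLinearEquivOfDetNeZero hT0, ?_, ?_⟩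
  · rw [multivariateGaussian]
    congr 1
    ext x
    simp [hT]
  · have h3 : ((T.toContinuousLinearEquivOfDetNeZero hT0 :
        EuclideanSpace ℝ (Fin n) ≃L[ℝ] EuclideanSpace ℝ (Fin n)) :
        EuclideanSpace ℝ (Fin n) →ₗ[ℝ] EuclideanSpace ℝ (Fin n)) = T := by
      ext x; simp
    rw [h3, hdet, ← hsq, Real.log_abs, Real.log_pow]
    push_cast
    ring

/-- The mutual information between the function values and the noisy observations. -/
lemma mutualInfo_obsLaw (hk : ∀ x y, inner ℝ (φ x) (φ y) = k x y) (hlam : 0 < lam) {n : ℕ}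
    (xs : Fin n → A) :
    mutualInfo (obsLaw k lam xs) =
      ENNReal.ofReal (Real.log ((regGram k lam xs).det / lam ^ n) / 2) := by
  have hI : (lam • (1 : Matrix (Fin n) (Fin n) ℝ)).PosDef := Matrix.PosDef.one.smul hlam
  have hM := regGram_posDef hk hlam xs
  obtain ⟨LA, hA, hdA⟩ := exists_equiv_multivariateGaussian hM
  obtain ⟨LB, hB, hdB⟩ := exists_equiv_multivariateGaussian hI
  have h1 : obsLaw k lam xs = ((multivariateGaussian 0 (gram k xs)).prod (stdGaussian _)).map
      fun p => (p.1 + LB p.2, p.1) := by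
    have e : (multivariateGaussian 0 (gram k xs)).prod
        (multivariateGaussian 0 (lam • (1 : Matrix (Fin n) (Fin n) ℝ))) =
        ((multivariateGaussian 0 (gram k xs)).prod (stdGaussian _)).map (Prod.map id LB) := by
      rw [hB, ← Measure.map_prod_map _ _ measurable_id (by fun_prop), Measure.map_id]
    rw [obsLaw, e, Measure.map_map (by fun_prop) (by fun_prop)]
    rfl
  have h2 : (obsLaw k lam xs).fst = (stdGaussian _).map LA := by
    rw [← hA, obsLaw, Measure.fst, Measure.map_map (by fun_prop) (by fun_prop)]
    change (multivariateGaussian 0 (gram k xs)).conv _ = _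
    refine Measure.ext_of_charFun ?_
    ext t
    rw [charFun_conv, charFun_multivariateGaussian (gram_posSemidef hk xs),
      charFun_multivariateGaussian hI.posSemidef, charFun_multivariateGaussian hM.posSemidef,
      ← Complex.exp_add, regGram, Matrix.add_mulVec, dotProduct_add]
    congr 1
    push_cast
    simp
    ring
  rw [mutualInfo_gaussian_channel LA LB _ _ h1 h2, hdA, hdB, Real.log_div hM.det_pos.ne'
    (by positivity), Matrix.det_smul, Matrix.det_one, mul_one, Fintype.card_fin]
  ring_nf

/-- Each new point multiplies the ratio by `1 + v / λ`, and `0 ≤ v ≤ k(x,x) ≤ 1 ≤ λ` puts this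
factor in `[1, 2]`. -/
lemma det_regGram_div_bounds (hk : ∀ x y, inner ℝ (φ x) (φ y) = k x y) (hlam : 1 ≤ lam)
    (hk1 : ∀ x, k x x ≤ 1) {n : ℕ} (xs : Fin n → A) :
    1 ≤ (regGram k lam xs).det / lam ^ n ∧ (regGram k lam xs).det / lam ^ n ≤ 2 ^ n := by
  have h0 : 0 < lam := by linarith
  induction n with
  | zero => simp
  | succ n ih =>
    obtain ⟨h1, h2⟩ := ih fun i : Fin n => xs i.castSucc
    have h3 : (regGram k lam xs).det / lam ^ (n + 1) =
        (regGram k lam (fun i : Fin n => xs i.castSucc)).det / lam ^ n *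
          (1 + postVar k lam (fun i : Fin n => xs i.castSucc) (xs (Fin.last n)) / lam) := by
      rw [det_regGram_succ hk h0]
      field_simp
      ring
    have h4 := postVar_nonneg hk h0 (fun i : Fin n => xs i.castSucc) (xs (Fin.last n))
    have h5 : postVar k lam (fun i : Fin n => xs i.castSucc) (xs (Fin.last n)) / lam ≤ 1 := by
      rw [div_le_one h0]
      exact ((postVar_le hk h0 _ _).trans (hk1 _)).trans hlam
    have h6 := div_nonneg h4 h0.le
    rw [h3, pow_succ]
    constructor
    · nlinarith
    · gcongr
      linarith

lemma le_maxInfoGain (hk : ∀ x y, inner ℝ (φ x) (φ y) = k x y) (hlam : 1 ≤ lam)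
    (hk1 : ∀ x, k x x ≤ 1) {n : ℕ} (xs : Fin n → A) :
    Real.log ((regGram k lam xs).det / lam ^ n) / 2 ≤ maxInfoGain k lam n := by
  have h0 : 0 < lam := by linarith
  -- The supremum must be finite, since `toReal` would otherwise turn it into `0`.
  have hfin : (⨆ xs : Fin n → A, mutualInfo (obsLaw k lam xs)) ≤
      ENNReal.ofReal (Real.log (2 ^ n) / 2) := by
    refine iSup_le fun xs => ?_
    rw [mutualInfo_obsLaw hk h0]
    obtain ⟨h1, h2⟩ := det_regGram_div_bounds hk hlam hk1 xs
    gcongr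
  rw [maxInfoGain, ← ENNReal.ofReal_le_iff_le_toReal (hfin.trans_lt ENNReal.ofReal_lt_top).ne,
    ← mutualInfo_obsLaw hk h0]
  exact le_iSup (fun xs => mutualInfo (obsLaw k lam xs)) xs

/-- Appending an arbitrary point to a tuple never lowers the normalised determinant. -/
lemma maxInfoGain_mono [Nonempty A] (hk : ∀ x y, inner ℝ (φ x) (φ y) = k x y) (hlam : 1 ≤ lam)
    (hk1 : ∀ x, k x x ≤ 1) : Monotone (maxInfoGain k lam) := by
  have h0 : 0 < lam := by linarith
  refine monotone_nat_of_le_succ fun n => ?_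
  rw [maxInfoGain]
  refine ENNReal.toReal_le_of_le_ofReal ENNReal.toReal_nonneg (iSup_le fun xs => ?_)
  rw [mutualInfo_obsLaw hk h0]
  refine ENNReal.ofReal_le_ofReal (le_trans ?_ (le_maxInfoGain hk hlam hk1
    (Fin.snoc (α := fun _ => A) xs (Classical.arbitrary A))))
  have h1 := (det_regGram_div_bounds hk hlam hk1 xs).1
  refine div_le_div_of_nonneg_right (Real.log_le_log (by linarith) ?_) zero_le_two
  rw [det_regGram_succ hk h0]
  simp only [Fin.snoc_castSucc, Fin.snoc_last]
  have h4 := postVar_nonneg hk h0 xs (Classical.arbitrary A)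
  rw [div_le_div_iff₀ (by positivity) (by positivity), pow_succ]
  have := (regGram_posDef hk h0 xs).det_pos
  have h5 : 0 ≤ (regGram k lam xs).det * postVar k lam xs (Classical.arbitrary A) * lam ^ n := by
    positivity
  change (regGram k lam xs).det * _ ≤ (regGram k lam xs).det * _ * _
  nlinarith

/-- The information gained by observing one point repeatedly. -/
lemma log_one_add_le_maxInfoGain (hk : ∀ x y, inner ℝ (φ x) (φ y) = k x y) (hlam : 1 ≤ lam)
    (hk1 : ∀ x, k x x ≤ 1) (n : ℕ) (x : A) :
    Real.log (1 + n * k x x / lam) / 2 ≤ maxInfoGain k lam n := by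
  have h0 : 0 < lam := by linarith
  refine le_trans (le_of_eq ?_) (le_maxInfoGain hk hlam hk1 fun _ : Fin n => x)
  congr 2
  -- For a constant tuple the Gram matrix has rank at most one, so the matrix determinant lemma
  -- applies.
  have h1 : regGram k lam (fun _ : Fin n => x) = lam • (1 +
      Matrix.replicateCol Unit (fun _ : Fin n => k x x / lam) *
        Matrix.replicateRow Unit (fun _ : Fin n => (1 : ℝ))) := by
    ext i j
    simp only [gram, Matrix.add_apply, Matrix.of_apply, Matrix.smul_apply, smul_eq_mul,
      Matrix.mul_apply, Matrix.replicateCol_apply, Matrix.replicateRow_apply, Finset.univ_unique,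
      Finset.sum_singleton]
    field_simp
    ring
  rw [h1, Matrix.det_smul, Matrix.det_one_add_replicateCol_mul_replicateRow, Fintype.card_fin,
    mul_div_cancel_left₀ _ (by positivity)]
  simp [dotProduct, mul_div_assoc]

end InfoGain

/-! ### One round of the method of mixtures -/

section Mixture

/-- The exponent obtained by integrating `exp (ξ y - σ² ξ² / 2)` against a Gaussian law of `ξ`. -/
noncomputable def mixExponent (σ a b y : ℝ) : ℝ := (a * y ^ 2 + 2 * b * y - b ^ 2) / (2 * σ ^ 2 * (1 + a))

/-- The mixing frequency `ξ` as an affine function of a standard Gaussian variable `z`. -/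
noncomputable def mixFreq (σ a b z : ℝ) : ℝ := b / σ ^ 2 + √a / σ * z

/-- Completing the square in `z`: the coefficient of `-z² / 2` becomes `1 + a`, leaving an
unnormalised Gaussian of variance `1 / (1 + a)`. -/
lemma exp_mixFreq_mul_gaussianPDFReal {σ a : ℝ} (hσ : 0 < σ) (ha : 0 ≤ a) (b y z : ℝ) :
    Real.exp (mixFreq σ a b z * y - σ ^ 2 * mixFreq σ a b z ^ 2 / 2) * gaussianPDFReal 0 1 z =
      Real.exp (mixExponent σ a b y) / √(1 + a) *
        gaussianPDFReal (√a / σ * (y - b) / (1 + a)) (1 / (1 + a)).toNNReal z := by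
  have h1 : 0 < 1 + a := by linarith
  have hs : √a ^ 2 = a := Real.sq_sqrt ha
  rw [gaussianPDFReal, gaussianPDFReal, Real.coe_toNNReal _ (by positivity)]
  have h2 : (√(2 * Real.pi * (1 / (1 + a))))⁻¹ = √(1 + a) * (√(2 * Real.pi * (1 : ℝ≥0)))⁻¹ := by
    rw [← Real.sqrt_inv, ← Real.sqrt_inv, ← Real.sqrt_mul h1.le]
    congr 1
    push_cast
    field_simp
  rw [h2]
  have h3 : Real.exp (mixFreq σ a b z * y - σ ^ 2 * mixFreq σ a b z ^ 2 / 2) *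
      Real.exp (-(z - 0) ^ 2 / (2 * (1 : ℝ≥0))) = Real.exp (mixExponent σ a b y) *
        Real.exp (-(z - √a / σ * (y - b) / (1 + a)) ^ 2 / (2 * (1 / (1 + a)))) := by
    rw [← Real.exp_add, ← Real.exp_add]
    congr 1
    simp only [mixFreq, mixExponent]
    generalize √a = s at hs
    subst hs
    push_cast
    field_simp
    ring
  have h4 : √(1 + a) ≠ 0 := by positivity
  calc _ = (√(2 * Real.pi * (1 : ℝ≥0)))⁻¹ * (Real.exp (mixFreq σ a b z * y -
        σ ^ 2 * mixFreq σ a b z ^ 2 / 2) * Real.exp (-(z - 0) ^ 2 / (2 * (1 : ℝ≥0)))) := by ring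
    _ = _ := by rw [h3]; field_simp

lemma ofReal_exp_mixExponent {σ a : ℝ} (hσ : 0 < σ) (ha : 0 ≤ a) (b y : ℝ) :
    ENNReal.ofReal (Real.exp (mixExponent σ a b y) / √(1 + a)) =
      ∫⁻ z, ENNReal.ofReal (Real.exp (mixFreq σ a b z * y - σ ^ 2 * mixFreq σ a b z ^ 2 / 2))
        ∂(gaussianReal 0 1) := by
  have h1 : 0 < 1 + a := by linarith
  have hv : (1 / (1 + a)).toNNReal ≠ 0 := (Real.toNNReal_pos.2 (by positivity)).ne'
  rw [gaussianReal_of_var_ne_zero 0 one_ne_zero,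
    lintegral_withDensity_eq_lintegral_mul _ (measurable_gaussianPDF 0 1)
      (by unfold mixFreq; fun_prop)]
  have h2 : ∀ z, (gaussianPDF 0 1 * fun z => ENNReal.ofReal
      (Real.exp (mixFreq σ a b z * y - σ ^ 2 * mixFreq σ a b z ^ 2 / 2))) z =
      ENNReal.ofReal (Real.exp (mixExponent σ a b y) / √(1 + a)) *
        gaussianPDF (√a / σ * (y - b) / (1 + a)) (1 / (1 + a)).toNNReal z := by
    intro z
    rw [Pi.mul_apply, gaussianPDF, gaussianPDF, ← ENNReal.ofReal_mul (gaussianPDFReal_nonneg _ _ _),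
      ← ENNReal.ofReal_mul (by positivity), mul_comm, exp_mixFreq_mul_gaussianPDFReal hσ ha]
  simp_rw [h2]
  rw [lintegral_const_mul _ (measurable_gaussianPDF _ _), lintegral_gaussianPDF_eq_one _ hv, mul_one]

variable {Ω : Type*} {m mΩ : MeasurableSpace Ω} {μ : Measure Ω} {Z : Ω → ℝ} {σ : ℝ}

/-- A form of conditional sub-Gaussianity given `m` that needs no conditional expectations. -/
def SubGaussianOn (m : MeasurableSpace Ω) {_mΩ : MeasurableSpace Ω} (Z : Ω → ℝ) (σ : ℝ)
    (μ : Measure Ω) : Prop :=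
  ∀ s : ℝ, ∀ A : Set Ω, MeasurableSet[m] A →
    ∫⁻ ω in A, ENNReal.ofReal (Real.exp (s * Z ω)) ∂μ ≤
      ENNReal.ofReal (Real.exp (s ^ 2 * σ ^ 2 / 2)) * μ A

/-- The hypothesis compares the measures with densities `X` and `Y` after restriction to `m`;
integrating an `m`-measurable weight only sees these restrictions. -/
lemma lintegral_mul_le_of_forall_setLIntegral_le (hm : m ≤ mΩ) {X Y W : Ω → ℝ≥0∞}
    (hX : Measurable X) (hY : Measurable Y)
    (h : ∀ A, MeasurableSet[m] A → ∫⁻ ω in A, X ω ∂μ ≤ ∫⁻ ω in A, Y ω ∂μ) (hW : Measurable[m] W) :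
    ∫⁻ ω, W ω * X ω ∂μ ≤ ∫⁻ ω, W ω * Y ω ∂μ := by
  have h1 : (μ.withDensity X).trim hm ≤ (μ.withDensity Y).trim hm := by
    refine Measure.le_iff.2 fun A hA => ?_
    rw [trim_measurableSet_eq hm hA, trim_measurableSet_eq hm hA, withDensity_apply _ (hm A hA),
      withDensity_apply _ (hm A hA)]
    exact h A hA
  have h2 := lintegral_mono' h1 (le_refl W)
  rw [lintegral_trim hm hW, lintegral_trim hm hW,
    lintegral_withDensity_eq_lintegral_mul _ hX (hW.mono hm le_rfl),
    lintegral_withDensity_eq_lintegral_mul _ hY (hW.mono hm le_rfl)] at h2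
  simpa [mul_comm] using h2

lemma SubGaussianOn.lintegral_mul_exp_le (hZ : SubGaussianOn m Z σ μ) (hm : m ≤ mΩ)
    (hZm : Measurable Z) {W : Ω → ℝ≥0∞} (hW : Measurable[m] W) (s : ℝ) :
    ∫⁻ ω, W ω * ENNReal.ofReal (Real.exp (s * Z ω)) ∂μ ≤
      ENNReal.ofReal (Real.exp (s ^ 2 * σ ^ 2 / 2)) * ∫⁻ ω, W ω ∂μ := by
  refine (lintegral_mul_le_of_forall_setLIntegral_le hm
    (Y := fun _ => ENNReal.ofReal (Real.exp (s ^ 2 * σ ^ 2 / 2))) (by fun_prop) (by fun_prop)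
    (fun A hA => ?_) hW).trans_eq ?_
  · rw [setLIntegral_const]; exact hZ s A hA
  · rw [lintegral_mul_const' _ _ ENNReal.ofReal_ne_top, mul_comm]

/-- On a fibre of `ξ` the frequency is constant, and the fibre lies in `m`, so its indicator can be
absorbed into the weight. -/
lemma SubGaussianOn.lintegral_simpleFunc_le (hZ : SubGaussianOn m Z σ μ) (hm : m ≤ mΩ)
    (hZm : Measurable Z) {W : Ω → ℝ≥0∞} (hW : Measurable[m] W) (ξ : @SimpleFunc Ω m ℝ) :
    ∫⁻ ω, W ω * ENNReal.ofReal (Real.exp (ξ ω * Z ω - σ ^ 2 * ξ ω ^ 2 / 2)) ∂μ ≤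
      ∫⁻ ω, W ω ∂μ := by
  have hset : ∀ r, MeasurableSet[m] (ξ ⁻¹' {r}) := fun r => @SimpleFunc.measurableSet_fiber Ω ℝ m ξ r
  have hpart : ∀ (F : ℝ → Ω → ℝ≥0∞) (ω : Ω),
      F (ξ ω) ω = ∑ r ∈ @SimpleFunc.range Ω ℝ m ξ, (ξ ⁻¹' {r}).indicator (F r) ω := by
    intro F ω
    rw [Finset.sum_eq_single (ξ ω)]
    · simp
    · intro r _ hr
      exact Set.indicator_of_notMem (by simpa using hr.symm) _
    · intro h
      exact absurd (@SimpleFunc.mem_range_self Ω ℝ m ξ ω) h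
  have hWm := hW.mono hm le_rfl
  rw [lintegral_congr (hpart fun r ω => W ω * ENNReal.ofReal
      (Real.exp (r * Z ω - σ ^ 2 * r ^ 2 / 2))),
    lintegral_congr (hpart fun _ ω => W ω), lintegral_finsetSum, lintegral_finsetSum]
  · refine Finset.sum_le_sum fun r _ => ?_
    have h1 := hZ.lintegral_mul_exp_le hm hZm (hW.indicator (hset r)) r
    have h2 : ∀ ω, (ξ ⁻¹' {r}).indicator (fun ω => W ω * ENNReal.ofReal
        (Real.exp (r * Z ω - σ ^ 2 * r ^ 2 / 2))) ω =
        ENNReal.ofReal (Real.exp (-(r ^ 2 * σ ^ 2 / 2))) *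
          ((ξ ⁻¹' {r}).indicator W ω * ENNReal.ofReal (Real.exp (r * Z ω))) := by
      intro ω
      by_cases hω : ω ∈ ξ ⁻¹' {r}
      · rw [Set.indicator_of_mem hω, Set.indicator_of_mem hω, mul_left_comm,
          ← ENNReal.ofReal_mul (by positivity), ← Real.exp_add]
        congr 3
        ring
      · rw [Set.indicator_of_notMem hω, Set.indicator_of_notMem hω]; simp
    rw [lintegral_congr h2, lintegral_const_mul' _ _ ENNReal.ofReal_ne_top]
    refine (mul_le_mul_right h1 _).trans_eq ?_
    rw [← mul_assoc, ← ENNReal.ofReal_mul (by positivity), ← Real.exp_add]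
    simp
  · exact fun r _ => hWm.indicator (hm _ (hset r))
  · exact fun r _ => (hWm.mul (by fun_prop)).indicator (hm _ (hset r))

/-- The sub-Gaussian bound at a random, past-measurable frequency. -/
lemma SubGaussianOn.lintegral_le (hZ : SubGaussianOn m Z σ μ) (hm : m ≤ mΩ)
    (hZm : Measurable Z) {W : Ω → ℝ≥0∞} (hW : Measurable[m] W) {ξ : Ω → ℝ} (hξ : Measurable[m] ξ) :
    ∫⁻ ω, W ω * ENNReal.ofReal (Real.exp (ξ ω * Z ω - σ ^ 2 * ξ ω ^ 2 / 2)) ∂μ ≤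
      ∫⁻ ω, W ω ∂μ := by
  have hs : StronglyMeasurable[m] ξ := hξ.stronglyMeasurable
  have hWm := hW.mono hm le_rfl
  have hlim : ∀ ω, Filter.Tendsto (fun j => W ω * ENNReal.ofReal
      (Real.exp (hs.approx j ω * Z ω - σ ^ 2 * hs.approx j ω ^ 2 / 2))) Filter.atTop
      (nhds (W ω * ENNReal.ofReal (Real.exp (ξ ω * Z ω - σ ^ 2 * ξ ω ^ 2 / 2)))) := by
    intro ω
    have h1 : Filter.Tendsto (fun j => ENNReal.ofReal
      (Real.exp (hs.approx j ω * Z ω - σ ^ 2 * hs.approx j ω ^ 2 / 2))) Filter.atTop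
      (nhds (ENNReal.ofReal (Real.exp (ξ ω * Z ω - σ ^ 2 * ξ ω ^ 2 / 2)))) := by
      have hc : Continuous fun r : ℝ => ENNReal.ofReal
        (Real.exp (r * Z ω - σ ^ 2 * r ^ 2 / 2)) :=
        ENNReal.continuous_ofReal.comp (by fun_prop)
      exact (hc.tendsto _).comp (hs.tendsto_approx ω)
    refine ENNReal.Tendsto.const_mul h1 (Or.inl ?_)
    exact (ENNReal.ofReal_pos.2 (Real.exp_pos _)).ne'
  have happ : ∀ j, Measurable (hs.approx j) := fun j =>
    (@SimpleFunc.measurable Ω ℝ m _ (hs.approx j)).mono hm le_rfl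
  -- Only an upper bound is wanted, so Fatou's lemma passes to the limit without any domination.
  calc _ = ∫⁻ ω, Filter.liminf (fun j => W ω * ENNReal.ofReal
        (Real.exp (hs.approx j ω * Z ω - σ ^ 2 * hs.approx j ω ^ 2 / 2))) Filter.atTop ∂μ :=
        lintegral_congr fun ω => (hlim ω).liminf_eq.symm
    _ ≤ Filter.liminf (fun j => ∫⁻ ω, W ω * ENNReal.ofReal
        (Real.exp (hs.approx j ω * Z ω - σ ^ 2 * hs.approx j ω ^ 2 / 2)) ∂μ) Filter.atTop := by
        refine lintegral_liminf_le fun j => ?_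
        have := happ j
        fun_prop
    _ ≤ _ := Filter.liminf_le_of_le (by isBoundedDefault) fun b hb => by
        obtain ⟨j, hj⟩ := hb.exists
        exact hj.trans (hZ.lintegral_simpleFunc_le hm hZm hW _)

/-- One step of the method of mixtures. -/
lemma SubGaussianOn.lintegral_mix_le [SFinite μ] (hZ : SubGaussianOn m Z σ μ) (hm : m ≤ mΩ)
    (hσ : 0 < σ) (hZm : Measurable Z) {W : Ω → ℝ≥0∞} (hW : Measurable[m] W) {a b : Ω → ℝ}
    (ha : Measurable[m] a) (hb : Measurable[m] b) (ha0 : ∀ ω, 0 ≤ a ω) :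
    ∫⁻ ω, W ω * ENNReal.ofReal (Real.exp (mixExponent σ (a ω) (b ω) (Z ω)) / √(1 + a ω)) ∂μ ≤
      ∫⁻ ω, W ω ∂μ := by
  have hWm := hW.mono hm le_rfl
  have ham := ha.mono hm le_rfl
  have hbm := hb.mono hm le_rfl
  have hmeas : Measurable fun p : Ω × ℝ => W p.1 * ENNReal.ofReal
      (Real.exp (mixFreq σ (a p.1) (b p.1) p.2 * Z p.1 -
        σ ^ 2 * mixFreq σ (a p.1) (b p.1) p.2 ^ 2 / 2)) := by
    unfold mixFreq; fun_prop
  calc _ = ∫⁻ ω, ∫⁻ z, W ω * ENNReal.ofReal (Real.exp (mixFreq σ (a ω) (b ω) z * Z ω -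
        σ ^ 2 * mixFreq σ (a ω) (b ω) z ^ 2 / 2)) ∂(gaussianReal 0 1) ∂μ := by
        refine lintegral_congr fun ω => ?_
        rw [ofReal_exp_mixExponent hσ (ha0 ω), lintegral_const_mul _ (by unfold mixFreq; fun_prop)]
    _ = ∫⁻ z, ∫⁻ ω, W ω * ENNReal.ofReal (Real.exp (mixFreq σ (a ω) (b ω) z * Z ω -
        σ ^ 2 * mixFreq σ (a ω) (b ω) z ^ 2 / 2)) ∂μ ∂(gaussianReal 0 1) :=
        lintegral_lintegral_swap hmeas.aemeasurable
    -- For fixed `z` the mixing frequency depends on `a` and `b` alone and is therefore determined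
    -- by the past.
    _ ≤ ∫⁻ _, ∫⁻ ω, W ω ∂μ ∂(gaussianReal 0 1) := by
        refine lintegral_mono fun z => hZ.lintegral_le hm hZm hW (ξ := fun ω =>
          mixFreq σ (a ω) (b ω) z) ?_
        unfold mixFreq
        exact (hb.div_const _).add ((ha.sqrt.div_const _).mul_const _)
    _ = _ := by simp

end Mixture

/-! ### Ville's inequality -/

section Ville

variable {Ω : Type*} {mΩ : MeasurableSpace Ω} {μ : Measure Ω}

/-- Ville's maximal inequality for nonnegative supermartingales. -/
lemma measure_exists_lt_le (ℱ : ℕ → MeasurableSpace Ω) (hmono : Monotone ℱ) (hle : ∀ n, ℱ n ≤ mΩ)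
    (M : ℕ → Ω → ℝ≥0∞) (hM : ∀ n, Measurable[ℱ n] (M n)) (h0 : ∫⁻ ω, M 0 ω ∂μ ≤ 1)
    (hstep : ∀ n A, MeasurableSet[ℱ n] A → ∫⁻ ω in A, M (n + 1) ω ∂μ ≤ ∫⁻ ω in A, M n ω ∂μ)
    (c : ℝ≥0∞) :
    μ {ω | ∃ n, c < M n ω} ≤ c⁻¹ := by
  set G : ℕ → Set Ω := fun N => {ω | ∀ n ≤ N, M n ω ≤ c} with hG
  have hGm : ∀ N, MeasurableSet[ℱ N] (G N) := by
    intro N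
    have : G N = ⋂ n ∈ Set.Iic N, {ω | M n ω ≤ c} := by ext ω; simp [hG]
    rw [this]
    refine MeasurableSet.biInter (Set.to_countable _) fun n hn => ?_
    exact hmono hn _ (measurableSet_le (hM n) measurable_const)
  have hMm : ∀ n, Measurable (M n) := fun n => (hM n).mono (hle n) le_rfl
  have hsucc : ∀ N, G (N + 1) = G N ∩ {ω | M (N + 1) ω ≤ c} := by
    intro N
    ext ω
    simp only [hG, Set.mem_ofPred_eq, Set.mem_inter_iff]
    refine ⟨fun h => ⟨fun n hn => h n (by omega), h _ le_rfl⟩, fun h n hn => ?_⟩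
    rcases Nat.lt_or_ge n (N + 1) with h' | h'
    · exact h.1 n (by omega)
    · obtain rfl : n = N + 1 := by omega
      exact h.2
  -- The supermartingale stopped on first exceeding `c`: paths that have crossed contribute at least
  -- `c`, the others contribute the current value, and the total never exceeds the initial mean.
  have key : ∀ N, c * μ (G N)ᶜ + ∫⁻ ω in G N, M N ω ∂μ ≤ 1 := by
    intro N
    induction N with
    | zero =>
      refine le_trans ?_ h0
      rw [← lintegral_add_compl (μ := μ) (M 0) (hle 0 _ (hGm 0)), add_comm]
      gcongr
      rw [← setLIntegral_const]
      refine setLIntegral_mono (hMm 0) fun ω hω => ?_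
      simp only [hG, Nat.le_zero, forall_eq, Set.mem_compl_iff, Set.mem_ofPred_eq, not_le] at hω
      exact hω.le
    | succ N ih =>
      refine le_trans ?_ ih
      have hsub : G (N + 1) ⊆ G N := by rw [hsucc]; exact Set.inter_subset_left
      have hm1 := hle _ _ (hGm (N + 1))
      have hm0 := hle _ _ (hGm N)
      have e1 : (G (N + 1))ᶜ = (G N)ᶜ ∪ (G N \ G (N + 1)) := by
        ext ω
        have := @hsub ω
        simp only [Set.mem_compl_iff, Set.mem_union, Set.mem_sdiff]
        tauto
      have e2 : μ (G (N + 1))ᶜ = μ (G N)ᶜ + μ (G N \ G (N + 1)) := by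
        rw [e1, measure_union _ (hm0.diff hm1)]
        exact disjoint_compl_left.mono_right Set.sdiff_subset
      have e3 : ∫⁻ ω in G N, M (N + 1) ω ∂μ = ∫⁻ ω in G (N + 1), M (N + 1) ω ∂μ +
          ∫⁻ ω in G N \ G (N + 1), M (N + 1) ω ∂μ := by
        rw [← lintegral_inter_add_sdiff _ (G N) hm1, Set.inter_eq_right.2 hsub]
      have e4 : c * μ (G N \ G (N + 1)) ≤ ∫⁻ ω in G N \ G (N + 1), M (N + 1) ω ∂μ := by
        rw [← setLIntegral_const]
        refine setLIntegral_mono (hMm _) fun ω hω => ?_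
        rw [hsucc] at hω
        simp only [Set.mem_sdiff, Set.mem_inter_iff, Set.mem_ofPred_eq, not_and, not_le] at hω
        exact (hω.2 hω.1).le
      rw [e2, mul_add, add_assoc]
      gcongr
      refine le_trans ?_ (hstep N _ (hGm N))
      rw [e3, add_comm]
      gcongr
  have hU : {ω | ∃ n, c < M n ω} = ⋃ N, (G N)ᶜ := by
    ext ω
    simp only [hG, Set.mem_ofPred_eq, Set.mem_iUnion, Set.mem_compl_iff, not_forall, not_le]
    exact ⟨fun ⟨n, hn⟩ => ⟨n, n, le_rfl, hn⟩, fun ⟨_, n, _, hn⟩ => ⟨n, hn⟩⟩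
  have hmonoG : Monotone fun N => (G N)ᶜ := by
    intro N N' h
    exact Set.compl_subset_compl.2 fun ω hω n hn => hω n (hn.trans h)
  rw [hU, hmonoG.measure_iUnion]
  refine iSup_le fun N => ?_
  rw [ENNReal.le_inv_iff_mul_le, mul_comm]
  exact le_self_add.trans (key N)

end Ville

/-! ### Conditional laws and the equivalent noise -/

section ConditionalLaw

variable {D : Type*} [MeasurableSpace D] {S : Set D} {Ω : Type*} {m mΩ : MeasurableSpace Ω}
  {μ : Measure Ω}

lemma CondSubGaussian.subGaussianOn [IsFiniteMeasure μ] (hm : m ≤ mΩ) {Z : Ω → ℝ} {σ : ℝ}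
    (h : CondSubGaussian m Z σ μ) : SubGaussianOn m Z σ μ := by
  intro s A hA
  obtain ⟨hint, hle⟩ := h s
  rw [← ofReal_integral_eq_lintegral_ofReal hint.integrableOn
    (Filter.Eventually.of_forall fun ω => (Real.exp_pos _).le), ← setIntegral_condExp hm hint hA]
  have h1 : ∫ ω in A, (μ[fun ω' => Real.exp (s * Z ω') | m]) ω ∂μ ≤
      ∫ _ in A, Real.exp (s ^ 2 * σ ^ 2 / 2) ∂μ :=
    setIntegral_mono_ae integrable_condExp.integrableOn (integrable_const _) hle
  refine (ENNReal.ofReal_le_ofReal h1).trans_eq ?_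
  rw [setIntegral_const, smul_eq_mul, ENNReal.ofReal_mul measureReal_nonneg, ofReal_measureReal,
    mul_comm]

lemma HasCondLaw.measure_inter_preimage [IsFiniteMeasure μ] (hm : m ≤ mΩ) {Y : Ω → D}
    (hY : Measurable Y) {κ : Ω → Measure D} [∀ ω, IsFiniteMeasure (κ ω)]
    (h : HasCondLaw m Y κ μ) {A : Set Ω} (hA : MeasurableSet[m] A) {s : Set D}
    (hs : MeasurableSet s) : μ (A ∩ Y ⁻¹' s) = ∫⁻ ω in A, κ ω s ∂μ := by
  have hint : Integrable ((Y ⁻¹' s).indicator fun _ => (1 : ℝ)) μ :=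
    (integrable_const _).indicator (hY hs)
  have h1 := setIntegral_condExp hm hint hA
  have hκ : Integrable (fun ω => (κ ω).real s) μ := integrable_condExp.congr (h s hs)
  rw [setIntegral_congr_ae (hm A hA) ((h s hs).mono fun ω h _ => h),
    setIntegral_indicator (hY hs), setIntegral_const, smul_eq_mul, mul_one] at h1
  rw [← ofReal_measureReal, ← h1, ofReal_integral_eq_lintegral_ofReal hκ.integrableOn
    (Filter.Eventually.of_forall fun ω => measureReal_nonneg)]
  simp

lemma measurable_expVal (P : Kernel S D) [IsSFiniteKernel P] {f : D → ℝ} (hf : Measurable f) :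
    Measurable (expVal P f) := by
  unfold expVal
  exact (hf.stronglyMeasurable.integral_kernel (κ := P)).measurable

/-- Integration of a function of the target and the queried location, against a weight that is
determined before the query. -/
lemma HasCondLaw.lintegral_eq [IsFiniteMeasure μ] (hm : m ≤ mΩ) {q : Ω → D} (hq : Measurable q)
    {P : Kernel S D} [IsMarkovKernel P] {x : Ω → S} (hx : Measurable[m] x)
    (h : HasCondLaw m q (fun ω => P (x ω)) μ) {W : Ω → ℝ≥0∞} (hW : Measurable[m] W)
    (hWfin : ∫⁻ ω, W ω ∂μ ≠ ∞) {F : S × D → ℝ≥0∞} (hF : Measurable F) :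
    ∫⁻ ω, W ω * F (x ω, q ω) ∂μ = ∫⁻ ω, W ω * ∫⁻ z, F (x ω, z) ∂(P (x ω)) ∂μ := by
  have hxm := hx.mono hm le_rfl
  have hWm := hW.mono hm le_rfl
  have hfin : IsFiniteMeasure (μ.withDensity W) := isFiniteMeasure_withDensity hWfin
  have hpair : Measurable fun ω => (x ω, q ω) := hxm.prodMk hq
  -- The weight is absorbed into the base measure. Both sides are then finite measures on a product
  -- and need only be compared on rectangles.
  have key : (μ.withDensity W).map (fun ω => (x ω, q ω)) = ((μ.withDensity W).map x) ⊗ₘ P := by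
    refine Measure.ext_prod fun {u v} hu hv => ?_
    have hPv : Measurable fun y => P y v := P.measurable_coe hv
    have hxu : MeasurableSet[m] (x ⁻¹' u) := hx hu
    rw [Measure.map_apply hpair (hu.prod hv), Measure.compProd_apply_prod hu hv,
      setLIntegral_map hu hPv hxm, ← lintegral_indicator (hm _ hxu)]
    have e1 : (fun ω => (x ω, q ω)) ⁻¹' (u ×ˢ v) = x ⁻¹' u ∩ q ⁻¹' v := rfl
    rw [e1, withDensity_apply _ ((hm _ hxu).inter (hq hv)),
      ← lintegral_indicator ((hm _ hxu).inter (hq hv)),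
      lintegral_withDensity_eq_lintegral_mul _ hWm
        (show Measurable ((x ⁻¹' u).indicator fun ω => P (x ω) v) from
          (hPv.comp hxm).indicator (hm _ hxu))]
    have hX : Measurable ((q ⁻¹' v).indicator fun _ => (1 : ℝ≥0∞)) :=
      measurable_const.indicator (hq hv)
    have hset : ∀ A, MeasurableSet[m] A → ∫⁻ ω in A, (q ⁻¹' v).indicator (fun _ => (1 : ℝ≥0∞)) ω ∂μ =
        ∫⁻ ω in A, P (x ω) v ∂μ := by
      intro A hA
      rw [← h.measure_inter_preimage hm hq hA hv, lintegral_indicator_const (hq hv), one_mul,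
        Measure.restrict_apply (hq hv), Set.inter_comm]
    have hW' : Measurable[m] ((x ⁻¹' u).indicator W) := hW.indicator hxu
    have e2 := le_antisymm
      (lintegral_mul_le_of_forall_setLIntegral_le hm hX (hPv.comp hxm)
        (fun A hA => (hset A hA).le) hW')
      (lintegral_mul_le_of_forall_setLIntegral_le hm (hPv.comp hxm) hX
        (fun A hA => (hset A hA).ge) hW')
    convert e2 using 1
    · refine lintegral_congr fun ω => ?_
      by_cases h1 : x ω ∈ u <;> by_cases h2 : q ω ∈ v <;> simp [Set.indicator, h1, h2]
    · refine lintegral_congr fun ω => ?_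
      by_cases h1 : x ω ∈ u <;> simp [Set.indicator, h1]
  have hin : Measurable fun y : S => ∫⁻ z, F (y, z) ∂(P y) := hF.lintegral_kernel_prod_right'
  have h1 := congrArg (fun ρ => ∫⁻ p, F p ∂ρ) key
  rw [lintegral_map hF hpair, Measure.lintegral_compProd hF, lintegral_map hin hxm,
    lintegral_withDensity_eq_lintegral_mul _ hWm
      (show Measurable fun ω => F (x ω, q ω) from hF.comp hpair),
    lintegral_withDensity_eq_lintegral_mul _ hWm
      (show Measurable fun ω => ∫⁻ z, F (x ω, z) ∂(P (x ω)) from hin.comp hxm)] at h1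
  exact h1

/-- The equivalent noise is conditionally sub-Gaussian. -/
lemma subGaussianOn_query_noise [IsProbabilityMeasure μ] (hm : m ≤ mΩ) {P : Kernel S D}
    [IsMarkovKernel P] {f : D → ℝ} (hf : Measurable f) {x : Ω → S} (hx : Measurable[m] x)
    {q : Ω → D} (hq : Measurable q) {ζ : Ω → ℝ} (hζ : Measurable ζ)
    (hlaw : HasCondLaw (m ⊔ MeasurableSpace.comap ζ inferInstance) q (fun ω => P (x ω)) μ)
    {σq σζ : ℝ≥0}
    (hP : ∀ x : S, HasSubgaussianMGF (fun z => f z - expVal P f x) (σq ^ 2) (P x))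
    (hsub : SubGaussianOn m ζ σζ μ) :
    SubGaussianOn m (fun ω => f (q ω) + ζ ω - expVal P f (x ω))
      (√((σq : ℝ) ^ 2 + (σζ : ℝ) ^ 2)) μ := by
  intro s A hA
  have hG : m ⊔ MeasurableSpace.comap ζ inferInstance ≤ mΩ := sup_le hm hζ.comap_le
  have hxG := hx.mono (le_sup_left (b := MeasurableSpace.comap ζ inferInstance)) le_rfl
  have hζG : Measurable[m ⊔ MeasurableSpace.comap ζ inferInstance] ζ :=
    (comap_measurable ζ).mono le_sup_right le_rfl
  have hAG : MeasurableSet[m ⊔ MeasurableSpace.comap ζ inferInstance] A :=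
    (le_sup_left (b := MeasurableSpace.comap ζ inferInstance)) A hA
  -- The noise factor is known once `ζ` is added to the past, so it serves as a weight while the
  -- query location is integrated out.
  set W : Ω → ℝ≥0∞ := A.indicator fun ω => ENNReal.ofReal (Real.exp (s * ζ ω)) with hWdef
  have hW : Measurable[m ⊔ MeasurableSpace.comap ζ inferInstance] W :=
    Measurable.indicator ((hζG.const_mul s).exp.ennreal_ofReal) hAG
  have hWint : ∫⁻ ω, W ω ∂μ ≤ ENNReal.ofReal (Real.exp (s ^ 2 * (σζ : ℝ) ^ 2 / 2)) * μ A := by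
    rw [hWdef, lintegral_indicator (hm _ hA)]
    exact hsub s A hA
  have hWfin : ∫⁻ ω, W ω ∂μ ≠ ∞ :=
    ne_top_of_le_ne_top (ENNReal.mul_ne_top ENNReal.ofReal_ne_top (measure_ne_top μ A)) hWint
  have hexp := measurable_expVal P hf
  set F : S × D → ℝ≥0∞ := fun p => ENNReal.ofReal (Real.exp (s * (f p.2 - expVal P f p.1)))
  have hF : Measurable F := by fun_prop
  have hFle : ∀ y : S, ∫⁻ z, F (y, z) ∂(P y) ≤
      ENNReal.ofReal (Real.exp (s ^ 2 * (σq : ℝ) ^ 2 / 2)) := by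
    intro y
    rw [← ofReal_integral_eq_lintegral_ofReal ((hP y).integrable_exp_mul s)
      (Filter.Eventually.of_forall fun z => (Real.exp_pos _).le)]
    refine ENNReal.ofReal_le_ofReal (((hP y).mgf_le s).trans_eq ?_)
    push_cast
    ring_nf
  calc ∫⁻ ω in A, ENNReal.ofReal (Real.exp (s * (f (q ω) + ζ ω - expVal P f (x ω)))) ∂μ
      = ∫⁻ ω, W ω * F (x ω, q ω) ∂μ := by
        rw [← lintegral_indicator (hm _ hA)]
        refine lintegral_congr fun ω => ?_
        by_cases h1 : ω ∈ A
        · simp only [hWdef, Set.indicator_of_mem h1, F]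
          rw [← ENNReal.ofReal_mul (by positivity), ← Real.exp_add]
          congr 2
          ring
        · simp [hWdef, Set.indicator_of_notMem h1]
    _ = ∫⁻ ω, W ω * ∫⁻ z, F (x ω, z) ∂(P (x ω)) ∂μ := hlaw.lintegral_eq hG hq hxG hW hWfin hF
    _ ≤ ∫⁻ ω, W ω * ENNReal.ofReal (Real.exp (s ^ 2 * (σq : ℝ) ^ 2 / 2)) ∂μ :=
        lintegral_mono fun ω => mul_le_mul_right (hFle (x ω)) _
    _ = (∫⁻ ω, W ω ∂μ) * ENNReal.ofReal (Real.exp (s ^ 2 * (σq : ℝ) ^ 2 / 2)) :=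
        lintegral_mul_const' _ _ ENNReal.ofReal_ne_top
    _ ≤ ENNReal.ofReal (Real.exp (s ^ 2 * (σζ : ℝ) ^ 2 / 2)) * μ A *
          ENNReal.ofReal (Real.exp (s ^ 2 * (σq : ℝ) ^ 2 / 2)) := mul_le_mul_left hWint _
    _ = _ := by
        rw [mul_right_comm, ← ENNReal.ofReal_mul (by positivity), ← Real.exp_add,
          Real.sq_sqrt (by positivity)]
        congr 3
        ring

end ConditionalLaw

/-! ### Measurability of the posterior mean and variance -/

section Measurability

variable {Ω A : Type*} {m : MeasurableSpace Ω} [MeasurableSpace A] {k : A → A → ℝ} {lam : ℝ}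

lemma measurable_det {n : ℕ} {M : Ω → Matrix (Fin n) (Fin n) ℝ}
    (hM : ∀ i j, Measurable fun ω => M ω i j) : Measurable fun ω => (M ω).det := by
  simp_rw [Matrix.det_apply]
  refine Finset.measurable_sum _ fun σ _ => ?_
  exact (Finset.measurable_prod _ fun i _ => hM _ _).const_smul _

lemma measurable_inv_apply {n : ℕ} {M : Ω → Matrix (Fin n) (Fin n) ℝ}
    (hM : ∀ i j, Measurable fun ω => M ω i j) (i j : Fin n) :
    Measurable fun ω => (M ω)⁻¹ i j := by
  simp_rw [Matrix.inv_def, Matrix.smul_apply, Ring.inverse_eq_inv', smul_eq_mul,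
    Matrix.adjugate_apply]
  refine (measurable_det hM).inv.mul (measurable_det fun i' j' => ?_)
  simp_rw [Matrix.updateRow_apply]
  split_ifs
  · exact measurable_const
  · exact hM _ _

variable (hk : Measurable fun p : A × A => k p.1 p.2) {n : ℕ} {xs : Fin n → Ω → A}
  (hxs : ∀ i, Measurable (xs i)) {x : Ω → A} (hx : Measurable x)
include hk hxs

lemma measurable_regGram_apply (i j : Fin n) :
    Measurable fun ω => regGram k lam (fun i => xs i ω) i j := by
  simp only [Matrix.add_apply, gram, Matrix.of_apply]
  exact (hk.comp ((hxs i).prodMk (hxs j))).add measurable_const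

include hx

lemma measurable_postMean {ys : Fin n → Ω → ℝ} (hys : ∀ i, Measurable (ys i)) :
    Measurable fun ω => postMean k lam (fun i => xs i ω) (fun i => ys i ω) (x ω) := by
  simp only [postMean, dotProduct, Matrix.mulVec, covVec]
  refine Finset.measurable_sum _ fun i _ => (hk.comp (hx.prodMk (hxs i))).mul
    (Finset.measurable_sum _ fun j _ => Measurable.mul ?_ (hys j))
  exact measurable_inv_apply (measurable_regGram_apply hk hxs) i j

lemma measurable_postVar :
    Measurable fun ω => postVar k lam (fun i => xs i ω) (x ω) := by
  simp only [postVar, dotProduct, Matrix.mulVec, covVec]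
  refine (hk.comp (hx.prodMk hx)).sub (Finset.measurable_sum _ fun i _ =>
    (hk.comp (hx.prodMk (hxs i))).mul
    (Finset.measurable_sum _ fun j _ => Measurable.mul ?_ (hk.comp (hx.prodMk (hxs j)))))
  exact measurable_inv_apply (measurable_regGram_apply hk hxs) i j

end Measurability

/-! ### The self-normalised mixture process -/

section Supermartingale

variable {A E : Type*} [NormedAddCommGroup E] [InnerProductSpace ℝ E] {φ : A → E}
  {k : A → A → ℝ} {lam : ℝ}

/-- The mixture supermartingale of the self-normalised process. -/
noncomputable def mixProcess (φ : A → E) (k : A → A → ℝ) (lam σ : ℝ) (x : ℕ → A) (ν : ℕ → ℝ)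
    (t : ℕ) : ℝ :=
  Real.exp (selfNorm φ k lam (fun i : Fin t => x i) (fun i : Fin t => ν i) / (2 * σ ^ 2)) /
    √((regGram k lam (fun i : Fin t => x i)).det / lam ^ t)

lemma mixProcess_zero (σ : ℝ) (x : ℕ → A) (ν : ℕ → ℝ) : mixProcess φ k lam σ x ν 0 = 1 := by
  simp [mixProcess, selfNorm, featSum]

/-- The two rank-one updates match: the increment of `selfNorm` gives `mixExponent`, and the
determinant ratio gives `1 + a`. -/
lemma mixProcess_succ (hk : ∀ x y, inner ℝ (φ x) (φ y) = k x y) (hlam : 0 < lam) {σ : ℝ}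
    (hσ : 0 < σ) (x : ℕ → A) (ν : ℕ → ℝ) (t : ℕ) :
    mixProcess φ k lam σ x ν (t + 1) = mixProcess φ k lam σ x ν t *
      (Real.exp (mixExponent σ (postVar k lam (fun i : Fin t => x i) (x t) / lam)
        (postMean k lam (fun i : Fin t => x i) (fun i : Fin t => ν i) (x t)) (ν t)) /
        √(1 + postVar k lam (fun i : Fin t => x i) (x t) / lam)) := by
  set a := postVar k lam (fun i : Fin t => x i) (x t) / lam with ha
  set b := postMean k lam (fun i : Fin t => x i) (fun i : Fin t => ν i) (x t) with hb
  have ha0 : 0 ≤ a := div_nonneg (postVar_nonneg hk hlam _ _) hlam.le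
  have h1 := selfNorm_succ hk hlam (fun i : Fin (t + 1) => x i) (fun i : Fin (t + 1) => ν i) a b
    (by simp [ha]) (by simp [hb])
  have h2 := det_regGram_succ hk hlam (fun i : Fin (t + 1) => x i)
  simp only [Fin.val_castSucc, Fin.val_last] at h1 h2
  have h3 : (regGram k lam (fun i : Fin (t + 1) => x i)).det / lam ^ (t + 1) =
      (regGram k lam (fun i : Fin t => x i)).det / lam ^ t * (1 + a) := by
    rw [h2, ha]
    field_simp
    ring
  have hd := (regGram_posDef hk hlam (fun i : Fin t => x i)).det_pos
  rw [mixProcess, mixProcess, h1, h3, Real.sqrt_mul (by positivity), add_div, Real.exp_add,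
    mul_div_mul_comm]
  congr 3
  rw [mixExponent]
  field_simp

end Supermartingale

/-! ### Time-uniform concentration of the noise -/

section Problem

variable {D : Type*} [MeasurableSpace D] {S : Set D} {Ω : Type*} {mΩ : MeasurableSpace Ω}
  {P : Kernel S D} {f : D → ℝ} {x : ℕ → Ω → S} {q : ℕ → Ω → D} {ζ : ℕ → Ω → ℝ}

lemma measurable_history {i t : ℕ} (h : i < t) :
    Measurable[history P f x q ζ t] fun ω => (x i ω, equivNoise P f x q ζ i ω) := by
  exact Measurable.of_comap_le (le_iSup (fun i : Fin t => MeasurableSpace.comap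
    (fun ω => (x i ω, equivNoise P f x q ζ i ω)) inferInstance) ⟨i, h⟩)

lemma history_mono : Monotone (history P f x q ζ) := by
  intro s t hst
  refine iSup_le fun i => ?_
  exact (measurable_history (i.2.trans_le hst)).comap_le

/-- Strong induction is needed because `x i` is known to be measurable only for its own history,
which must first be compared with `mΩ`. -/
lemma history_le [IsSFiniteKernel P] (hf : Measurable f)
    (hx : ∀ t, Measurable[history P f x q ζ t] (x t)) (hq : ∀ t, Measurable (q t))
    (hζ : ∀ t, Measurable (ζ t)) (t : ℕ) : history P f x q ζ t ≤ mΩ := by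
  induction t using Nat.strong_induction_on with
  | _ t ih =>
    refine iSup_le fun i => ?_
    have hxi : Measurable (x i) := (hx i).mono (ih i i.2) le_rfl
    exact (hxi.prodMk (((hf.comp (hq i)).add (hζ i)).sub
      ((measurable_expVal P hf).comp hxi))).comap_le

variable {E : Type*} [NormedAddCommGroup E] [InnerProductSpace ℝ E] {φ : S → E}
  {k : S → S → ℝ} {lam σ : ℝ} {μ : Measure Ω} [IsProbabilityMeasure μ]

/-- The self-normalised concentration inequality, uniformly in time. -/
lemma measure_selfNorm_le (hk : ∀ x y, inner ℝ (φ x) (φ y) = k x y)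
    (hkm : Measurable fun p : S × S => k p.1 p.2) (hlam : 0 < lam) (hσ : 0 < σ)
    (hle : ∀ t, history P f x q ζ t ≤ mΩ)
    (hx : ∀ t, Measurable[history P f x q ζ t] (x t))
    (hν : ∀ t, SubGaussianOn (history P f x q ζ t) (equivNoise P f x q ζ t) σ μ)
    {δ : ℝ} (hδ : 0 < δ) :
    ENNReal.ofReal (1 - δ) ≤ μ {ω | ∀ t : ℕ,
      selfNorm φ k lam (fun i : Fin t => x i ω) (fun i : Fin t => equivNoise P f x q ζ i ω) ≤
        2 * σ ^ 2 * (Real.log ((regGram k lam fun i : Fin t => x i ω).det / lam ^ t) / 2 +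
          Real.log (1 / δ))} := by
  set ν := equivNoise P f x q ζ with hνdef
  set ℱ := history P f x q ζ with hℱ
  have hxm : ∀ {i t : ℕ}, i < t → Measurable[ℱ t] (x i) := fun h => (measurable_history h).fst
  have hνm : ∀ {i t : ℕ}, i < t → Measurable[ℱ t] (ν i) := fun h => (measurable_history h).snd
  set M : ℕ → Ω → ℝ≥0∞ := fun t ω => ENNReal.ofReal
    (mixProcess φ k lam σ (fun i => x i ω) (fun i => ν i ω) t) with hM
  set a : ℕ → Ω → ℝ := fun t ω => postVar k lam (fun i : Fin t => x i ω) (x t ω) / lam with ha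
  set b : ℕ → Ω → ℝ := fun t ω =>
    postMean k lam (fun i : Fin t => x i ω) (fun i : Fin t => ν i ω) (x t ω) with hb
  have ham : ∀ t, Measurable[ℱ t] (a t) := fun t =>
    (measurable_postVar hkm (fun i : Fin t => hxm i.2) (hx t)).div_const _
  have hbm : ∀ t, Measurable[ℱ t] (b t) := fun t =>
    measurable_postMean hkm (fun i : Fin t => hxm i.2) (hx t) (fun i : Fin t => hνm i.2)
  have ha0 : ∀ t ω, 0 ≤ a t ω := fun t ω => div_nonneg (postVar_nonneg hk hlam _ _) hlam.le
  have hsucc : ∀ t ω, M (t + 1) ω = M t ω *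
      ENNReal.ofReal (Real.exp (mixExponent σ (a t ω) (b t ω) (ν t ω)) / √(1 + a t ω)) := by
    intro t ω
    simp only [hM]
    rw [mixProcess_succ hk hlam hσ, ENNReal.ofReal_mul (by unfold mixProcess; positivity)]
  have hMm : ∀ t, Measurable[ℱ t] (M t) := by
    intro t
    induction t with
    | zero => simp only [hM, mixProcess_zero]; exact measurable_const
    | succ t ih =>
      have h1 := (ham t).mono (history_mono t.le_succ) le_rfl
      have h2 := (hbm t).mono (history_mono t.le_succ) le_rfl
      have h3 := hνm t.lt_succ_self
      have h4 := ih.mono (history_mono t.le_succ) le_rfl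
      rw [funext (hsucc t)]
      unfold mixExponent
      exact h4.mul (Measurable.ennreal_ofReal (Measurable.div (Measurable.exp (Measurable.div
        (((h1.mul (h3.pow_const 2)).add ((h2.const_mul 2).mul h3)).sub (h2.pow_const 2))
        ((h1.const_add 1).const_mul _))) (h1.const_add 1).sqrt))
  have hνmeas : ∀ t, Measurable (ν t) := fun t => (hνm t.lt_succ_self).mono (hle _) le_rfl
  -- The one-round mixture bound with weight `M t` restricted to the past event `B`.
  have hstep : ∀ t B, MeasurableSet[ℱ t] B → ∫⁻ ω in B, M (t + 1) ω ∂μ ≤ ∫⁻ ω in B, M t ω ∂μ := by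
    intro t B hB
    have h1 := (hν t).lintegral_mix_le (hle t) hσ (hνmeas t) ((hMm t).indicator hB) (ham t)
      (hbm t) (ha0 t)
    rw [← lintegral_indicator (hle _ _ hB), ← lintegral_indicator (hle _ _ hB)]
    refine le_trans (le_of_eq (lintegral_congr fun ω => ?_)) h1
    by_cases h : ω ∈ B <;> simp [Set.indicator, h, hsucc]
  have hville := measure_exists_lt_le (μ := μ) ℱ history_mono hle M hMm
    (by simp [hM, mixProcess_zero]) hstep (ENNReal.ofReal (1 / δ))
  have hBm : MeasurableSet {ω | ∃ n, ENNReal.ofReal (1 / δ) < M n ω} := by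
    simp only [Set.ofPred_exists]
    exact MeasurableSet.iUnion fun n =>
      measurableSet_lt measurable_const ((hMm n).mono (hle n) le_rfl)
  have h1 : ENNReal.ofReal (1 - δ) ≤ μ {ω | ∃ n, ENNReal.ofReal (1 / δ) < M n ω}ᶜ := by
    rw [prob_compl_eq_one_sub hBm, ENNReal.ofReal_sub _ hδ.le, ENNReal.ofReal_one]
    refine tsub_le_tsub_left (hville.trans_eq ?_) _
    rw [← ENNReal.ofReal_inv_of_pos (by positivity), one_div, inv_inv]
  refine h1.trans (measure_mono fun ω hω t => ?_)
  simp only [Set.mem_compl_iff, Set.mem_ofPred_eq, not_exists, not_lt] at hω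
  have h2 := hω t
  simp only [hM] at h2
  rw [ENNReal.ofReal_le_ofReal_iff (by positivity), mixProcess] at h2
  have hd := (regGram_posDef hk hlam (fun i : Fin t => x i ω)).det_pos
  set r := (regGram k lam (fun i : Fin t => x i ω)).det / lam ^ t with hr
  have hr0 : 0 < r := by positivity
  rw [div_le_iff₀ (by positivity)] at h2
  have h3 := Real.log_le_log (Real.exp_pos _) h2
  rw [Real.log_exp, Real.log_mul (by positivity) (by positivity), Real.log_sqrt hr0.le,
    div_le_iff₀ (by positivity)] at h3
  linarith

end Problem

/-! ### From confidence intervals to regret -/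

section Regret

variable {A E : Type*} [NormedAddCommGroup E] [InnerProductSpace ℝ E] {φ : A → E}
  {k : A → A → ℝ} {lam : ℝ}

lemma sum_log_one_add_postVar (hk : ∀ x y, inner ℝ (φ x) (φ y) = k x y) (hlam : 0 < lam)
    (x : ℕ → A) (n : ℕ) :
    ∑ t ∈ Finset.range n, Real.log (1 + postVar k lam (fun i : Fin t => x i) (x t) / lam) =
      Real.log ((regGram k lam fun i : Fin n => x i).det / lam ^ n) := by
  induction n with
  | zero => simp
  | succ n ih =>
    have h2 := det_regGram_succ hk hlam (fun i : Fin (n + 1) => x i)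
    simp only [Fin.val_castSucc, Fin.val_last] at h2
    have h3 := (regGram_posDef hk hlam (fun i : Fin n => x i)).det_pos
    have h4 := postVar_nonneg hk hlam (fun i : Fin n => x i) (x n)
    rw [Finset.sum_range_succ, ih, ← Real.log_mul (by positivity) (by positivity), h2]
    congr 1
    field_simp
    ring

lemma maxInfoGain_nonneg (n : ℕ) : 0 ≤ maxInfoGain k lam n := ENNReal.toReal_nonneg

/-- The sum of the posterior variances is controlled by the information gain. -/
lemma sum_postVar_le (hk : ∀ x y, inner ℝ (φ x) (φ y) = k x y) (hlam : 1 ≤ lam)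
    (hk1 : ∀ x, k x x ≤ 1) (x : ℕ → A) (n : ℕ) :
    ∑ t ∈ Finset.range n, postVar k lam (fun i : Fin t => x i) (x t) ≤
      4 * lam * maxInfoGain k lam n := by
  have h0 : 0 < lam := by linarith
  have h1 := le_maxInfoGain hk hlam hk1 (fun i : Fin n => x i)
  rw [← sum_log_one_add_postVar hk h0] at h1
  calc _ ≤ ∑ t ∈ Finset.range n,
        2 * lam * Real.log (1 + postVar k lam (fun i : Fin t => x i) (x t) / lam) := by
        refine Finset.sum_le_sum fun t _ => ?_
        have h2 := postVar_nonneg hk h0 (fun i : Fin t => x i) (x t)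
        have h3 := (postVar_le hk h0 (fun i : Fin t => x i) (x t)).trans (hk1 _)
        set v := postVar k lam (fun i : Fin t => x i) (x t)
        have h4 := Real.one_sub_inv_le_log_of_pos (show 0 < 1 + v / lam by positivity)
        -- Here `v ≤ 1 ≤ λ`, hence `λ + v ≤ 2 λ`; so `v ≤ 2 λ log (1 + v / λ)`.
        have h5 : v / (2 * lam) ≤ 1 - (1 + v / lam)⁻¹ := by
          have : 1 - (1 + v / lam)⁻¹ = v / (lam + v) := by field_simp; ring
          rw [this]
          gcongr
          linarith
        have h6 := h5.trans h4
        rw [div_le_iff₀ (by positivity)] at h6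
        linarith
    _ = 2 * lam * ∑ t ∈ Finset.range n,
        Real.log (1 + postVar k lam (fun i : Fin t => x i) (x t) / lam) := by
        rw [Finset.mul_sum]
    _ ≤ _ := by nlinarith

lemma sum_sqrt_postVar_le (hk : ∀ x y, inner ℝ (φ x) (φ y) = k x y) (hlam : 1 ≤ lam)
    (hk1 : ∀ x, k x x ≤ 1) (x : ℕ → A) (n : ℕ) :
    ∑ t ∈ Finset.range n, √(postVar k lam (fun i : Fin t => x i) (x t)) ≤
      2 * √lam * √(n * maxInfoGain k lam n) := by
  have h0 : 0 < lam := by linarith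
  have h1 := sq_sum_le_card_mul_sum_sq (s := Finset.range n)
    (f := fun t => √(postVar k lam (fun i : Fin t => x i) (x t)))
  simp_rw [fun t : ℕ => Real.sq_sqrt (postVar_nonneg hk h0 (fun i : Fin t => x i) (x t))] at h1
  rw [Finset.card_range] at h1
  have h2 : 2 * √lam * √(n * maxInfoGain k lam n) =
      √(n * (4 * lam * maxInfoGain k lam n)) := by
    rw [show n * (4 * lam * maxInfoGain k lam n) = 2 ^ 2 * (lam * (n * maxInfoGain k lam n)) by ring,
      Real.sqrt_mul (by norm_num) (lam * _), Real.sqrt_sq (by norm_num), Real.sqrt_mul h0.le, mul_assoc]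
  rw [h2]
  apply Real.le_sqrt_of_sq_le
  refine h1.trans ?_
  gcongr
  exact sum_postVar_le hk hlam hk1 x n

/-- If the information gain of `n` rounds is small then so is the kernel on the diagonal. -/
lemma natCast_mul_sqrt_kernel_le (hk : ∀ x y, inner ℝ (φ x) (φ y) = k x y) (hlam : 1 ≤ lam)
    (hk1 : ∀ x, k x x ≤ 1) {n : ℕ} (hn : maxInfoGain k lam n < 1) (x : A) :
    n * √(k x x) ≤ 4 * √lam * √(n * maxInfoGain k lam n) := by
  have h0 : 0 < lam := by linarith
  have hkx : 0 ≤ k x x := by rw [← hk]; exact real_inner_self_nonneg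
  have h1 := log_one_add_le_maxInfoGain hk hlam hk1 n x
  set γ := maxInfoGain k lam n
  set u := n * k x x / lam with hu
  have hu0 : 0 ≤ u := by positivity
  -- As `γ < 1` forces `log (1 + u) < 2`, `1 + u` is below `e² < 8`. On this range `log (1 + u) ≥ u
  -- / 8`, which turns the bound `2 γ` on the logarithm into `u ≤ 16 γ`.
  have h2 : 1 + u < 8 := by
    have h3 : Real.log (1 + u) < 2 := by linarith
    rw [Real.log_lt_iff_lt_exp (by positivity)] at h3
    have h4 : Real.exp 2 = Real.exp 1 * Real.exp 1 := by rw [← Real.exp_add]; norm_num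
    have h5 := Real.exp_one_lt_d9
    have h6 := Real.exp_pos 1
    nlinarith
  have h3 := Real.one_sub_inv_le_log_of_pos (show 0 < 1 + u by positivity)
  have h4 : u / 8 ≤ 1 - (1 + u)⁻¹ := by
    have : 1 - (1 + u)⁻¹ = u / (1 + u) := by field_simp; ring
    rw [this]
    gcongr
  have h5 : n * k x x ≤ 16 * γ * lam := by
    rw [← div_le_iff₀ h0, ← hu]; linarith
  have h6 : 4 * √lam * √(n * γ) = √(n * (16 * γ * lam)) := by
    rw [show n * (16 * γ * lam) = 4 ^ 2 * (lam * (n * γ)) by ring,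
      Real.sqrt_mul (by norm_num) (lam * _), Real.sqrt_sq (by norm_num), Real.sqrt_mul h0.le, mul_assoc]
  rw [h6]
  apply Real.le_sqrt_of_sq_le
  rw [mul_pow, Real.sq_sqrt hkx, sq, mul_assoc]
  gcongr

variable {g : E} {B σ δ : ℝ} {x : ℕ → A} {y : ℕ → ℝ}

/-- The instantaneous regret is at most twice the width of the confidence interval. -/
lemma regret_le_width (hk : ∀ x y, inner ℝ (φ x) (φ y) = k x y) (hlam : 1 ≤ lam)
    (hk1 : ∀ x, k x x ≤ 1) (hg : ‖g‖ ≤ B) (hσ : 0 < σ) {t : ℕ}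
    (hself : selfNorm φ k lam (fun i : Fin t => x i)
        (fun i : Fin t => y i - inner ℝ (φ (x i)) g) ≤
      2 * σ ^ 2 * (Real.log ((regGram k lam fun i : Fin t => x i).det / lam ^ t) / 2 +
        Real.log (1 / δ)))
    (hmax : ∀ x', ucb k lam (igpBeta k lam B σ δ t) (fun i : Fin t => x i) (fun i : Fin t => y i) x' ≤
      ucb k lam (igpBeta k lam B σ δ t) (fun i : Fin t => x i) (fun i : Fin t => y i) (x t))
    (x' : A) :
    inner ℝ (φ x') g - inner ℝ (φ (x t)) g ≤
      2 * igpBeta k lam B σ δ t * √(postVar k lam (fun i : Fin t => x i) (x t)) := by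
  have h0 : 0 < lam := by linarith
  have hconf : ∀ z, |postMean k lam (fun i : Fin t => x i) (fun i : Fin t => y i) z -
      inner ℝ (φ z) g| ≤
      igpBeta k lam B σ δ t * √(postVar k lam (fun i : Fin t => x i) z) := by
    intro z
    refine (abs_postMean_sub_le hk h0 (fun i : Fin t => x i) (fun i : Fin t => y i)
      (fun i : Fin t => y i - inner ℝ (φ (x i)) g) g (fun i => by ring) z).trans ?_
    rw [igpBeta]
    gcongr
    have h1 := le_maxInfoGain hk hlam hk1 (fun i : Fin t => x i)
    have h2 := selfNorm_nonneg hk h0 (fun i : Fin t => x i)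
      (fun i : Fin t => y i - inner ℝ (φ (x i)) g)
    set Q := selfNorm φ k lam (fun i : Fin t => x i)
      (fun i : Fin t => y i - inner ℝ (φ (x i)) g)
    set γ := maxInfoGain k lam t
    -- Since `λ ≥ 1`, division by `λ` can be dropped; the `+ 1` in `β` is slack here.
    calc √(Q / lam) ≤ √(σ ^ 2 * (2 * (γ + 1 + Real.log (1 / δ)))) := by
          apply Real.sqrt_le_sqrt
          refine (div_le_self h2 hlam).trans (hself.trans ?_)
          have h3 : 0 ≤ σ ^ 2 := sq_nonneg σ
          nlinarith
      _ = _ := by rw [Real.sqrt_mul (sq_nonneg σ), Real.sqrt_sq hσ.le]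
  have h1 := abs_le.1 (hconf x')
  have h2 := abs_le.1 (hconf (x t))
  have h3 := hmax x'
  rw [ucb, ucb] at h3
  linarith [h1.1, h2.2]

/-- The cumulative regret bound on the event where the confidence intervals are valid. -/
lemma sum_regret_le [Nonempty A] (hk : ∀ x y, inner ℝ (φ x) (φ y) = k x y) (hlam : 1 ≤ lam)
    (hk1 : ∀ x, k x x ≤ 1) (hg : ‖g‖ ≤ B) (hσ : 0 < σ) (hδ : 0 < δ) (hδ1 : δ < 1)
    (hself : ∀ t : ℕ, selfNorm φ k lam (fun i : Fin t => x i)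
        (fun i : Fin t => y i - inner ℝ (φ (x i)) g) ≤
      2 * σ ^ 2 * (Real.log ((regGram k lam fun i : Fin t => x i).det / lam ^ t) / 2 +
        Real.log (1 / δ)))
    (hmax : ∀ t x', ucb k lam (igpBeta k lam B σ δ t) (fun i : Fin t => x i) (fun i : Fin t => y i) x' ≤
      ucb k lam (igpBeta k lam B σ δ t) (fun i : Fin t => x i) (fun i : Fin t => y i) (x t))
    (n : ℕ) :
    ∑ t ∈ Finset.range n, ((⨆ x', inner ℝ (φ x') g) - inner ℝ (φ (x t)) g) ≤
      8 * √lam * (B * √(n * maxInfoGain k lam n) +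
        σ * √(n * maxInfoGain k lam n * (maxInfoGain k lam n + Real.log (1 / δ)))) := by
  have hB : 0 ≤ B := (norm_nonneg g).trans hg
  have hL : 0 ≤ Real.log (1 / δ) := Real.log_nonneg (by rw [le_div_iff₀ hδ]; linarith)
  set L := Real.log (1 / δ)
  set γ := maxInfoGain k lam n with hγ
  have hγ0 : 0 ≤ γ := maxInfoGain_nonneg n
  -- For small `γ` the width of the confidence intervals is too crude, and each round is bounded by
  -- `2 B` times the largest `√(k(z,z))` instead.
  rcases lt_or_ge γ 1 with h1 | h1
  · set T := B * (8 * √lam * √(n * γ)) with hT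
    have hround : ∀ t, n * ((⨆ x', inner ℝ (φ x') g) - inner ℝ (φ (x t)) g) ≤ T := by
      intro t
      have hnk : ∀ z, n * |inner ℝ (φ z) g| ≤ B * (4 * √lam * √(n * γ)) := by
        intro z
        have h2 : ‖φ z‖ = √(k z z) := by rw [← hk, real_inner_self_eq_norm_sq, Real.sqrt_sq (norm_nonneg _)]
        calc n * |inner ℝ (φ z) g| ≤ n * (‖φ z‖ * ‖g‖) := by
              gcongr; exact abs_real_inner_le_norm _ _
          _ = ‖g‖ * (n * √(k z z)) := by rw [h2]; ring
          _ ≤ _ := mul_le_mul hg (natCast_mul_sqrt_kernel_le hk hlam hk1 h1 z)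
              (by positivity) hB
      rcases Nat.eq_zero_or_pos n with rfl | hn
      · simp only [Nat.cast_zero, zero_mul]; positivity
      · have hn' : (0 : ℝ) < n := by exact_mod_cast hn
        rw [← le_div_iff₀' hn', sub_le_iff_le_add]
        refine ciSup_le fun x' => ?_
        rw [← sub_le_iff_le_add, le_div_iff₀' hn', mul_sub]
        have h3 := hnk x'
        have h4 := hnk (x t)
        have h5 : (n : ℝ) * inner ℝ (φ x') g ≤ n * |inner ℝ (φ x') g| := by
          gcongr; exact le_abs_self _
        have h6 : -(n * |inner ℝ (φ (x t)) g|) ≤ (n : ℝ) * inner ℝ (φ (x t)) g := by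
          rw [← mul_neg]; gcongr; exact neg_abs_le _
        linarith
    have hsum : ∑ t ∈ Finset.range n, ((⨆ x', inner ℝ (φ x') g) - inner ℝ (φ (x t)) g) ≤ T := by
      rcases Nat.eq_zero_or_pos n with hn | hn
      · rw [hn, Finset.range_zero, Finset.sum_empty]; positivity
      · have hn' : (0 : ℝ) < n := by exact_mod_cast hn
        refine (Finset.sum_le_card_nsmul _ _ (T / n) fun t _ => ?_).trans_eq ?_
        · rw [le_div_iff₀' hn']; exact hround t
        · rw [Finset.card_range, nsmul_eq_mul, mul_div_cancel₀ _ hn'.ne']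
    have : 0 ≤ 8 * √lam * (σ * √(n * γ * (γ + L))) := by positivity
    calc _ ≤ T := hsum
      _ ≤ _ := by rw [hT]; linarith
  · set β := B + σ * √(2 * (γ + 1 + L)) with hβ
    have hβ0 : 0 ≤ β := by positivity
    -- Because `γ ≥ 1`, the constant is absorbed: `2 (γ + 1 + L) ≤ 4 (γ + L)`.
    have hβle : β ≤ 2 * (B + σ * √(γ + L)) := by
      have : √(2 * (γ + 1 + L)) ≤ 2 * √(γ + L) := by
        refine Real.sqrt_le_iff.2 ⟨by positivity, ?_⟩
        rw [mul_pow, Real.sq_sqrt (by positivity)]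
        linarith
      rw [hβ]
      nlinarith
    calc _ ≤ ∑ t ∈ Finset.range n, 2 * β * √(postVar k lam (fun i : Fin t => x i) (x t)) := by
          refine Finset.sum_le_sum fun t ht => ?_
          have hbt : igpBeta k lam B σ δ t ≤ β := by
            rw [igpBeta, hβ]
            have := maxInfoGain_mono hk hlam hk1 (Finset.mem_range.1 ht).le
            gcongr
          rw [sub_le_iff_le_add]
          refine ciSup_le fun x' => ?_
          rw [← sub_le_iff_le_add]
          refine (regret_le_width hk hlam hk1 hg hσ (hself t) (hmax t) x').trans ?_
          gcongr
      _ = 2 * β * ∑ t ∈ Finset.range n, √(postVar k lam (fun i : Fin t => x i) (x t)) := by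
          rw [Finset.mul_sum]
      _ ≤ 2 * (2 * (B + σ * √(γ + L))) * (2 * √lam * √(n * γ)) := by
          gcongr
          exact sum_sqrt_postVar_le hk hlam hk1 x n
      _ = _ := by
          rw [Real.sqrt_mul (by positivity) (γ + L)]
          ring

end Regret

/-! ### Feature map of a reproducing kernel Hilbert space -/

section Kernel

variable {A : Type*} {H : Type*} [NormedAddCommGroup H] [InnerProductSpace ℝ H]
  [CompleteSpace H] [RKHS ℝ H A ℝ] {k : A → A → ℝ}

lemma IsRKHSOf.inner_kerFun (h : IsRKHSOf H k) (x y : A) :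
    inner ℝ (RKHS.kerFun H x (1 : ℝ)) (RKHS.kerFun H y (1 : ℝ)) = k x y := by
  rw [RKHS.kerFun_inner, RKHS.kerFun_apply, h]
  simp

lemma inner_kerFun_one (x : A) (f : H) : inner ℝ (RKHS.kerFun H x (1 : ℝ)) f = f x := by
  rw [RKHS.kerFun_inner]
  simp

/-- The functions of the RKHS of a continuous kernel are continuous. -/
lemma IsRKHSOf.continuous [TopologicalSpace A] (h : IsRKHSOf H k)
    (hk : Continuous fun p : A × A => k p.1 p.2) (f : H) : Continuous f := by
  have hφ : Continuous fun x : A => RKHS.kerFun H x (1 : ℝ) := by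
    refine continuous_iff_continuousAt.2 fun x => tendsto_iff_norm_sub_tendsto_zero.2 ?_
    have h1 : ∀ y, ‖RKHS.kerFun H y (1 : ℝ) - RKHS.kerFun H x (1 : ℝ)‖ =
        √(k y y - 2 * k y x + k x x) := by
      intro y
      rw [← Real.sqrt_sq (norm_nonneg _), norm_sub_sq_real, ← real_inner_self_eq_norm_sq,
        ← real_inner_self_eq_norm_sq, h.inner_kerFun, h.inner_kerFun, h.inner_kerFun]
    simp_rw [h1]
    have h2 : Continuous fun y => √(k y y - 2 * k y x + k x x) := by
      have e1 : Continuous fun y => k y y := hk.comp (continuous_id.prodMk continuous_id)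
      have e2 : Continuous fun y => k y x := hk.comp (continuous_id.prodMk continuous_const)
      fun_prop
    have h3 := h2.tendsto x
    rwa [show k x x - 2 * k x x + k x x = 0 by ring, Real.sqrt_zero] at h3
  have h4 : (f : A → ℝ) = fun x => inner ℝ (RKHS.kerFun H x (1 : ℝ)) f :=
    funext fun x => (inner_kerFun_one x f).symm
  rw [h4]
  exact hφ.inner continuous_const

end Kernel

end UncertainBO

/-! ### The regret theorem -/

theorem mainTheorem2 :
    ∀ lamMax : ℝ, 1 ≤ lamMax → ∃ C : ℝ, 0 < C ∧
      ∀ (d : ℕ) (X : Set (EuclideanSpace ℝ (Fin d))) (S : Set X), IsCompact S →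
      ∀ k : X → X → ℝ, Continuous (fun p : X × X => k p.1 p.2) → (∀ x, k x x ≤ 1) →
      ∀ (H : Type*) [NormedAddCommGroup H] [InnerProductSpace ℝ H] [CompleteSpace H]
        [RKHS ℝ H X ℝ], UncertainBO.IsRKHSOf H k →
      ∀ (HS : Type*) [NormedAddCommGroup HS] [InnerProductSpace ℝ HS] [CompleteSpace HS]
        [RKHS ℝ HS S ℝ], UncertainBO.IsRKHSOf HS (fun x y : S => k x y) →
      ∀ (P : Kernel S X) [IsMarkovKernel P] (f : H) (B : ℝ) (σq σζ : ℝ≥0) (lam δ : ℝ),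
        0 < σq → 1 ≤ lam → lam ≤ lamMax → 0 < δ → δ < 1 →
        -- the map `x ↦ E[f]` under `P x` is a function of `H_k(S)` of norm at most `B`
        (∃ g : HS, (∀ x : S, g x = UncertainBO.expVal P f x) ∧ ‖g‖ ≤ B) →
        -- the fluctuation of `f` under `P x` is `σq`-sub-Gaussian
        (∀ x : S, HasSubgaussianMGF (fun z => f z - UncertainBO.expVal P f x) (σq ^ 2) (P x)) →
      ∀ (Ω : Type*) [MeasurableSpace Ω] (μ : Measure Ω) [IsProbabilityMeasure μ]
        (x : ℕ → Ω → S) (q : ℕ → Ω → X) (ζ : ℕ → Ω → ℝ),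
        UncertainBO.IsNoisyExecution μ P f x q ζ →
        (∀ t, UncertainBO.CondSubGaussian (UncertainBO.history P f x q ζ t) (ζ t) σζ μ) →
      ∀ σν : ℝ, σν = Real.sqrt ((σq : ℝ) ^ 2 + (σζ : ℝ) ^ 2) →
      ∀ γ : ℕ → ℝ, γ = UncertainBO.maxInfoGain (fun x y : S => k x y) lam →
        UncertainBO.IsUCBSelection (fun x y : S => k x y) lam
          (UncertainBO.igpBeta (fun x y : S => k x y) lam B σν δ) P f x q ζ →
        ENNReal.ofReal (1 - δ) ≤ μ {ω | ∀ n : ℕ,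
          UncertainBO.cumRegret P f x n ω ≤
            C * (B * Real.sqrt (n * γ n) +
              σν * Real.sqrt (n * γ n * (γ n + Real.log (1 / δ))))} := by
  intro lamMax hlamMax
  -- The regret bound holds with `8 √λ`; in the main case this is `2` from the interval width, `2`
  -- from absorbing the constant in `β`, and `2 √λ` from the sum of the `σ_t`.
  refine ⟨8 * √lamMax, by positivity, ?_⟩
  intro d X S _ k hkc hk1 H _ _ _ _ hH HS _ _ _ _ hHS P _ f B σq σζ lam δ hσq hlam hlamle hδ hδ1
    hg hsub Ω _ μ _ x q ζ hexec hζ σν hσν γ hγ hsel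
  obtain ⟨g, hgP, hgB⟩ := hg
  -- A probability space has a point, whose first target shows that `S` is nonempty, as bounding the
  -- supremum over `S` requires.
  obtain ⟨ω₀⟩ : Nonempty Ω := μ.nonempty_of_neZero
  have hS : Nonempty S := ⟨x 0 ω₀⟩
  have h0 : 0 < lam := by linarith
  have hσν0 : 0 < σν := by
    have : (0 : ℝ) < σq := hσq
    rw [hσν]; positivity
  have hB : 0 ≤ B := (norm_nonneg g).trans hgB
  have hφ := hHS.inner_kerFun
  -- The ambient space `H` serves to make `f` continuous; the confidence analysis takes place in
  -- `HS`.
  have hfm : Measurable f := (hH.continuous hkc f).measurable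
  have hkm : Measurable fun p : S × S => k p.1 p.2 := by
    have h1 : Continuous fun p : S × S => k p.1 p.2 :=
      hkc.comp ((continuous_subtype_val.comp continuous_fst).prodMk
        (continuous_subtype_val.comp continuous_snd))
    exact h1.measurable
  have hle := UncertainBO.history_le hfm hsel.predictable hexec.measurable_query
    hexec.measurable_noise
  have hν : ∀ t, UncertainBO.SubGaussianOn (UncertainBO.history P f x q ζ t)
      (UncertainBO.equivNoise P f x q ζ t) σν μ := by
    intro t
    rw [hσν]
    exact UncertainBO.subGaussianOn_query_noise (hle t) hfm (hsel.predictable t)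
      (hexec.measurable_query t) (hexec.measurable_noise t) (hexec.condLaw t) hsub
      ((hζ t).subGaussianOn (hle t))
  refine (UncertainBO.measure_selfNorm_le hφ hkm h0 hσν0 hle hsel.predictable hν hδ).trans
    (measure_mono fun ω hω n => ?_)
  have hgx : ∀ y : S, UncertainBO.expVal P f y = inner ℝ (RKHS.kerFun HS y (1 : ℝ)) g := by
    intro y
    rw [UncertainBO.inner_kerFun_one, hgP]
  have hself : ∀ t : ℕ, UncertainBO.selfNorm (fun y => RKHS.kerFun HS y (1 : ℝ))
      (fun x y : S => k x y) lam (fun i : Fin t => x i ω)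
      (fun i : Fin t => UncertainBO.obs f q ζ i ω -
        inner ℝ (RKHS.kerFun HS (x i ω) (1 : ℝ)) g) ≤
      2 * σν ^ 2 * (Real.log ((UncertainBO.regGram (fun x y : S => k x y) lam
        fun i : Fin t => x i ω).det / lam ^ t) / 2 + Real.log (1 / δ)) := by
    intro t
    have h1 := hω t
    simp only [UncertainBO.equivNoise, hgx] at h1
    exact h1
  have hmain := UncertainBO.sum_regret_le (x := fun i => x i ω)
    (y := fun i => UncertainBO.obs f q ζ i ω) hφ hlam (fun y => hk1 y) hgB hσν0 hδ hδ1 hself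
    (fun t x' => hsel.maximises t ω x') n
  rw [← hγ] at hmain
  simp only [UncertainBO.cumRegret, hgx]
  refine hmain.trans ?_
  gcongr
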